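/- Let $D>0$, $v\ge 0$ and $k\in\mathbb{R}$ with $k>-\frac{v^2}{4D}$, let $a\in[0,+\infty]$, and set $\zeta:=\frac{1}{2D}\sqrt{v^2+4kD}$. For $n\ge 1$ let $\mu_n(+\infty)=0$, $\mu_n(0)=\frac12$ and, for $0<a<+\infty$, let $\mu_n(a)\in(0,\frac12)$ be the unique solution of $\tan(\mu_n\pi)+a^{-1}\mu_n\pi=a^{-1}n\pi$. Put $$G(\zeta,a):=\frac{\sqrt2}{\pi}\sqrt{\sum_{n=1}^{\infty}\frac{(n-\mu_n(a))^3}{\left((n-\mu_n(a))+(2\pi)^{-1}\sin(2\mu_n(a)\pi)\right)\left(\pi^{-2}\zeta^2+(n-\mu_n(a))^2\right)^2}}.$$ Consider the transport PDE $$\frac{\partial y}{\partial t}(t,z)=D\frac{\partial^2 y}{\partial z^2}(t,z)-v\frac{\partial y}{\partial z}(t,z)-k\,y(t,z),\qquad t>0,\ z\in(0,1),$$ with inlet condition $y(t,0)=d(t)$ for $t\ge 0$ and, for $t\ge0$, the exit condition $y(t,1)=0$ if $a=+\infty$, or $\frac{\partial y}{\partial z}(t,1)=\left(\frac{v}{2D}-a\right)y(t,1)$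 if $a<+\infty$. Then the series converges, and $$G(\zeta,a)=\sqrt{c_1^2\frac{e^{2\zeta}-1}{2\zeta}+c_2^2\frac{1-e^{-2\zeta}}{2\zeta}+2c_1c_2},\quad c_1=\frac{\zeta-a}{(\zeta+a)e^{2\zeta}+\zeta-a},\quad c_2=\frac{(\zeta+a)e^{2\zeta}}{(\zeta+a)e^{2\zeta}+\zeta-a}\qquad (a<+\infty),$$ $$G(\zeta,+\infty)=\frac{1}{e^{2\zeta}-1}\sqrt{\frac{e^{4\zeta}-1-4\zeta e^{2\zeta}}{2\zeta}}.$$ Moreover, for every $d\in C^2([0,\infty);\mathbb{R})$ and $y_0\in C^2([0,1];\mathbb{R})$ with $y_0(0)=d(0)$ and $y_0(1)=0$ (if $a=+\infty$) or $y_0'(1)=\left(\frac{v}{2D}-a\right)y_0(1)$ (if $a<+\infty$), there is exactly one function $y\in C^0([0,\infty)\times[0,1];\mathbb{R})\cap C^1((0,\infty)\times[0,1];\mathbb{R})$ with $y(t,\cdot)\in C^2([0,1];\mathbb{R})$ for all $t\ge0$ that satisfies the PDE, the inlet and exit conditions and $y(0,z)=y_0(z)$ for all $z\in[0,1]$. For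 all $t\ge0$ and $\varepsilon>0$ it satisfies $$\sqrt{\int_0^1 e^{-vz/D}y^2(t,z)\,dz}\le e^{-D(\zeta^2+\pi^2(1-\mu_1(a))^2)t}\sqrt{(1+\varepsilon)\int_0^1 e^{-vz/D}y_0^2(z)\,dz}+\sqrt{1+\varepsilon^{-1}}\;G(\zeta,a)\max_{0\le s\le t}|d(s)|.$$ -/

import Mathlib

open Set
open scoped ENNReal

namespace TransportPDE

noncomputable section

/-- The equation `tan (μ π) + a⁻¹ μ π = a⁻¹ n π` with `μ ∈ (0, 1/2)`, for a finite exit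
parameter `a > 0`. -/
def IsMuRoot (a : ℝ) (n : ℕ) (μ : ℝ) : Prop :=
  μ ∈ Ioo (0 : ℝ) (1 / 2) ∧
    Real.tan (μ * Real.pi) + a⁻¹ * (μ * Real.pi) = a⁻¹ * (n * Real.pi)

theorem existsUnique_isMuRoot {a : ℝ} (ha : 0 < a) {n : ℕ} (hn : 1 ≤ n) :
    ∃! μ : ℝ, IsMuRoot a n μ := by
  have hpi := Real.pi_pos
  have hn' : (1 : ℝ) ≤ n := by exact_mod_cast hn
  have hia : 0 < a⁻¹ := inv_pos.mpr ha
  have hcos : ∀ μ ∈ Ioo (0 : ℝ) (1 / 2), 0 < Real.cos (μ * Real.pi) := fun μ hμ =>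
    Real.cos_pos_of_mem_Ioo ⟨by nlinarith [hμ.1], by nlinarith [hμ.2]⟩
  obtain ⟨μ, hμ, h0⟩ : (0 : ℝ) ∈
      (fun μ : ℝ => a * Real.sin (μ * Real.pi) + (μ - n) * Real.pi * Real.cos (μ * Real.pi)) ''
        Ioo (0 : ℝ) (1 / 2) := by
    refine intermediate_value_Ioo (by norm_num) (by fun_prop) ⟨?_, ?_⟩
    · simp
      nlinarith
    · have h : (1 / 2 : ℝ) * Real.pi = Real.pi / 2 := by ring
      simp only [h, Real.sin_pi_div_two, Real.cos_pi_div_two]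
      linarith
  refine ⟨μ, ⟨hμ, ?_⟩, ?_⟩
  · have hc := (hcos μ hμ).ne'
    rw [Real.tan_eq_sin_div_cos]
    field_simp
    simp only at h0
    linarith
  · rintro ν ⟨hν, hν0⟩
    have hmono : StrictMonoOn
        (fun s : ℝ => Real.tan (s * Real.pi) + a⁻¹ * (s * Real.pi)) (Ioo (0 : ℝ) (1 / 2)) := by
      intro s hs t ht hst
      have h1 : s * Real.pi < t * Real.pi := by nlinarith
      have h2 : Real.tan (s * Real.pi) < Real.tan (t * Real.pi) :=
        Real.tan_lt_tan_of_lt_of_lt_pi_div_two (by nlinarith [hs.1]) (by nlinarith [ht.2]) h1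
      have h3 : a⁻¹ * (s * Real.pi) < a⁻¹ * (t * Real.pi) := mul_lt_mul_of_pos_left h1 hia
      exact add_lt_add h2 h3
    refine hmono.injOn hν hμ ?_
    have hc := (hcos μ hμ).ne'
    have hμ0 : Real.tan (μ * Real.pi) + a⁻¹ * (μ * Real.pi) = a⁻¹ * (n * Real.pi) := by
      rw [Real.tan_eq_sin_div_cos]
      field_simp
      simp only at h0
      linarith
    exact hν0.trans hμ0.symm

/-- The numbers `μ_n(a)`, `n ≥ 1`, for `a ∈ [0, +∞]`: `μ_n(+∞) = 0`, `μ_n(0) = 1/2`, and for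
`0 < a < +∞` the unique root in `(0, 1/2)` of `tan (μ π) + a⁻¹ μ π = a⁻¹ n π`
(`sInf` of the singleton of roots, see `isMuRoot_mu`). -/
def mu (n : ℕ) (a : ℝ≥0∞) : ℝ :=
  if a = ⊤ then 0 else if a = 0 then 1 / 2 else sInf {μ : ℝ | IsMuRoot a.toReal n μ}

theorem isMuRoot_mu {a : ℝ≥0∞} (h0 : a ≠ 0) (htop : a ≠ ⊤) {n : ℕ} (hn : 1 ≤ n) :
    IsMuRoot a.toReal n (mu n a) := by
  obtain ⟨μ, hμ, huniq⟩ := existsUnique_isMuRoot (ENNReal.toReal_pos h0 htop) hn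
  have hset : {μ : ℝ | IsMuRoot a.toReal n μ} = {μ} := by
    ext ν
    exact ⟨fun h => huniq ν h, fun h => by rw [mem_singleton_iff.mp h]; exact hμ⟩
  simpa [mu, h0, htop, hset] using hμ

/-- `ζ = √(v² + 4 k D) / (2 D)`. -/
def zeta (D v k : ℝ) : ℝ := 1 / (2 * D) * Real.sqrt (v ^ 2 + 4 * k * D)

/-- The `n`-th term (`n ≥ 1`) of the series that defines the gain. -/
def gainTerm (ζ : ℝ) (a : ℝ≥0∞) (n : ℕ) : ℝ :=
  (n - mu n a) ^ 3 /
    (((n - mu n a) + (2 * Real.pi)⁻¹ * Real.sin (2 * mu n a * Real.pi)) *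
      ((Real.pi ^ 2)⁻¹ * ζ ^ 2 + (n - mu n a) ^ 2) ^ 2)

/-- The gain `G(ζ, a) = (√2 / π) √(∑_{n ≥ 1} gainTerm ζ a n)`. -/
def gain (ζ : ℝ) (a : ℝ≥0∞) : ℝ :=
  Real.sqrt 2 / Real.pi * Real.sqrt (∑' n : ℕ, gainTerm ζ a (n + 1))

/-- Coefficient of `exp (ζ z)` in the steady state with inlet value `1` and finite exit
parameter `a`. -/
def c₁ (ζ a : ℝ) : ℝ := (ζ - a) / ((ζ + a) * Real.exp (2 * ζ) + ζ - a)

/-- Coefficient of `exp (-ζ z)` in the steady state with inlet value `1` and finite exit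
parameter `a`. -/
def c₂ (ζ a : ℝ) : ℝ :=
  ((ζ + a) * Real.exp (2 * ζ)) / ((ζ + a) * Real.exp (2 * ζ) + ζ - a)

/-- The closed form of the gain. -/
def gainClosedForm (ζ : ℝ) (a : ℝ≥0∞) : ℝ :=
  if a = ⊤ then
    1 / (Real.exp (2 * ζ) - 1) *
      Real.sqrt ((Real.exp (4 * ζ) - 1 - 4 * ζ * Real.exp (2 * ζ)) / (2 * ζ))
  else
    Real.sqrt (c₁ ζ a.toReal ^ 2 * ((Real.exp (2 * ζ) - 1) / (2 * ζ)) +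
      c₂ ζ a.toReal ^ 2 * ((1 - Real.exp (-2 * ζ)) / (2 * ζ)) +
      2 * c₁ ζ a.toReal * c₂ ζ a.toReal)

/-- The condition at the exit `z = 1` on a profile `w : [0,1] → ℝ`: Dirichlet for `a = +∞`, and
Robin (Neumann) `w'(1) = (v / (2 D) - a) w(1)` for `0 ≤ a < +∞`. -/
def ExitCondition (D v : ℝ) (a : ℝ≥0∞) (w : ℝ → ℝ) : Prop :=
  (a = ⊤ → w 1 = 0) ∧
    (a ≠ ⊤ → derivWithin w (Icc 0 1) 1 = (v / (2 * D) - a.toReal) * w 1)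

/-- Classical solutions, on all of `[0, ∞) × [0, 1]`, of
`y_t = D y_zz - v y_z - k y`, `y(t, 0) = d(t)`, with the exit condition of parameter `a` and
initial condition `y₀`. Only the values of `y` on `[0, ∞) × [0, 1]` matter. -/
structure IsSolution (D v k : ℝ) (a : ℝ≥0∞) (d y₀ : ℝ → ℝ) (y : ℝ → ℝ → ℝ) : Prop where
  /-- `y ∈ C⁰([0, ∞) × [0, 1])` -/
  continuousOn : ContinuousOn (fun q : ℝ × ℝ => y q.1 q.2) (Ici 0 ×ˢ Icc 0 1)
  /-- `y ∈ C¹((0, ∞) × [0, 1])` -/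
  contDiffOn : ContDiffOn ℝ 1 (fun q : ℝ × ℝ => y q.1 q.2) (Ioi 0 ×ˢ Icc 0 1)
  /-- `y[t] ∈ C²([0, 1])` -/
  profile : ∀ t, 0 ≤ t → ContDiffOn ℝ 2 (y t) (Icc 0 1)
  inlet : ∀ t, 0 ≤ t → y t 0 = d t
  exit : ∀ t, 0 ≤ t → ExitCondition D v a (y t)
  initial : ∀ z ∈ Icc (0 : ℝ) 1, y 0 z = y₀ z
  pde : ∀ t, 0 < t → ∀ z ∈ Ioo (0 : ℝ) 1,
    deriv (fun s => y s z) t = D * deriv (deriv (y t)) z - v * deriv (y t) z - k * y t z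

/-- `√(∫₀¹ exp (- v z / D) w(z)² dz)`, the weighted `L²` norm of a profile. -/
def weightedNorm (D v : ℝ) (w : ℝ → ℝ) : ℝ :=
  Real.sqrt (∫ z in (0 : ℝ)..1, Real.exp (-(v * z / D)) * w z ^ 2)

/-- `max_{0 ≤ s ≤ t} |d(s)|`. -/
def maxAbs (d : ℝ → ℝ) (t : ℝ) : ℝ := sSup ((fun s => |d s|) '' Icc 0 t)

end

end TransportPDE

/-! The substitution `u = exp (-v z / (2 D)) y` removes the drift: `u_t = D (u_zz - ζ² u)`, with
`u(t, 0) = d(t)` and exit condition `u_z = -a u` (or `u = 0`) at `z = 1`. The weighted norm of `y`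
is the plain `L²` norm of `u`. Let `ψ` be the steady state with inlet value `1`; it is nonnegative.

Estimate. If `|d| ≤ M` on `[0, t]`, both `u - M ψ` and `-u - M ψ` solve the equation with
nonpositive inlet value, so the `L²` norms of their positive parts decay at the rate of the first
eigenvalue (`HeatSol.energy_le`). The required Poincaré inequality for positive parts comes from
Jacobi's device, division by a positive solution of `φ'' = -κ² φ` (`integral_posPart_mul_nonpos`).
Since `|u|` is at most `M ψ` plus one of the two positive parts, Young's inequality gives the bound
with gain `‖ψ‖`. The case `d = 0` gives uniqueness.

Gain. Let `χ'' - ζ² χ = ψ` with `χ(0) = 0` and the exit condition. Green's identity gives `∫ ψ² =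
-χ'(0)`. The sine coefficients of `χ` decay like `ω_n⁻³`, so its expansion may be differentiated
termwise at `0`, and this produces the series in `gain`; the explicit exponentials in `ψ` produce
the closed form.

Completeness of the eigenfunctions is elementary: Wirtinger's inequality between grid points and a
min-max argument show that energy dominates `ω_n²` times mass orthogonally to the first `n + 1`
eigenfunctions (`freq_sq_mul_massForm_le`). Hence the remainders of an expansion tend to zero in
`L²`.

Existence. In `u = m + d ψ + (d' / D) χ` the two lifts absorb the inlet value and the source it
creates, and leave for `m` the source `-(d'' / D) χ`, whose sine coefficients are absolutely
summable. Then `m` is an explicit sum of modes (`exists_heatSol`). -/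

namespace TransportPDE

open MeasureTheory intervalIntegral Filter Topology

/-! ### Calculus of `C²` functions, Green's identity and extension from an interval -/

/-- `f` is twice continuously differentiable on `ℝ` with derivatives `f'` and `f''`. -/
structure IsC2 (f f' f'' : ℝ → ℝ) : Prop where
  hasDerivAt : ∀ x, HasDerivAt f (f' x) x
  hasDerivAt' : ∀ x, HasDerivAt f' (f'' x) x
  continuous'' : Continuous f''

namespace IsC2

variable {f f' f'' g g' g'' : ℝ → ℝ}

theorem continuous (h : IsC2 f f' f'') : Continuous f :=
  continuous_iff_continuousAt.2 fun x => (h.hasDerivAt x).continuousAt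

theorem continuous' (h : IsC2 f f' f'') : Continuous f' :=
  continuous_iff_continuousAt.2 fun x => (h.hasDerivAt' x).continuousAt

theorem add (hf : IsC2 f f' f'') (hg : IsC2 g g' g'') :
    IsC2 (fun x => f x + g x) (fun x => f' x + g' x) (fun x => f'' x + g'' x) :=
  ⟨fun x => (hf.hasDerivAt x).add (hg.hasDerivAt x),
    fun x => (hf.hasDerivAt' x).add (hg.hasDerivAt' x), hf.continuous''.add hg.continuous''⟩

theorem const_mul (hf : IsC2 f f' f'') (c : ℝ) :
    IsC2 (fun x => c * f x) (fun x => c * f' x) (fun x => c * f'' x) :=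
  ⟨fun x => (hf.hasDerivAt x).const_mul c, fun x => (hf.hasDerivAt' x).const_mul c,
    hf.continuous''.const_mul c⟩

theorem sub (hf : IsC2 f f' f'') (hg : IsC2 g g' g'') :
    IsC2 (fun x => f x - g x) (fun x => f' x - g' x) (fun x => f'' x - g'' x) :=
  ⟨fun x => (hf.hasDerivAt x).sub (hg.hasDerivAt x),
    fun x => (hf.hasDerivAt' x).sub (hg.hasDerivAt' x), hf.continuous''.sub hg.continuous''⟩

theorem mul (hf : IsC2 f f' f'') (hg : IsC2 g g' g'') :
    IsC2 (fun x => f x * g x) (fun x => f' x * g x + f x * g' x)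
      (fun x => f'' x * g x + 2 * (f' x * g' x) + f x * g'' x) := by
  refine ⟨fun x => (hf.hasDerivAt x).mul (hg.hasDerivAt x), fun x => ?_, ?_⟩
  · exact (((hf.hasDerivAt' x).mul (hg.hasDerivAt x)).add
      ((hf.hasDerivAt x).mul (hg.hasDerivAt' x))).congr_deriv (by ring)
  · exact ((hf.continuous''.mul hg.continuous).add
      ((hf.continuous'.mul hg.continuous').const_mul 2)).add (hf.continuous.mul hg.continuous'')

theorem contDiff_two (hf : IsC2 f f' f'') : ContDiff ℝ 2 f := by
  have h1 : deriv f = f' := funext fun x => (hf.hasDerivAt x).deriv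
  have h2 : deriv f' = f'' := funext fun x => (hf.hasDerivAt' x).deriv
  have e : (2 : WithTop ℕ∞) = 1 + 1 := by norm_num
  rw [e, contDiff_succ_iff_deriv]
  refine ⟨fun x => (hf.hasDerivAt x).differentiableAt, by simp, ?_⟩
  rw [h1, contDiff_one_iff_deriv, h2]
  exact ⟨fun x => (hf.hasDerivAt' x).differentiableAt, hf.continuous''⟩

/-- Green's identity. -/
theorem integral_green (hf : IsC2 f f' f'') (hg : IsC2 g g' g'') :
    ∫ z in (0 : ℝ)..1, (f'' z * g z - f z * g'' z) =
      (f' 1 * g 1 - f 1 * g' 1) - (f' 0 * g 0 - f 0 * g' 0) := by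
  refine integral_eq_sub_of_hasDerivAt (f := fun z => f' z * g z - f z * g' z) (fun x _ => ?_) ?_
  · exact (((hf.hasDerivAt' x).mul (hg.hasDerivAt x)).sub
      ((hf.hasDerivAt x).mul (hg.hasDerivAt' x))).congr_deriv (by ring)
  · exact ((hf.continuous''.mul hg.continuous).sub
      (hf.continuous.mul hg.continuous'')).intervalIntegrable _ _

end IsC2

theorem isC2_exp (c : ℝ) : IsC2 (fun z => Real.exp (c * z)) (fun z => c * Real.exp (c * z))
    (fun z => c ^ 2 * Real.exp (c * z)) := by
  have h : ∀ x, HasDerivAt (fun z => Real.exp (c * z)) (c * Real.exp (c * x)) x := fun x =>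
    (((hasDerivAt_id x).const_mul c).exp).congr_deriv (by simp; ring)
  exact ⟨h, fun x => ((h x).const_mul c).congr_deriv (by ring), by fun_prop⟩

theorem isC2_sin (θ c : ℝ) : IsC2 (fun z => Real.sin (θ + c * z))
    (fun z => c * Real.cos (θ + c * z)) (fun z => -c ^ 2 * Real.sin (θ + c * z)) := by
  have h0 : ∀ x, HasDerivAt (fun z => θ + c * z) c x := fun x =>
    (((hasDerivAt_id x).const_mul c).const_add θ).congr_deriv (by simp)
  exact ⟨fun x => (h0 x).sin.congr_deriv (by ring),
    fun x => ((h0 x).cos.const_mul c).congr_deriv (by ring), by fun_prop⟩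

/-- A `C²` function on an interval extends to a `C²` function on `ℝ`. -/
theorem exists_isC2_extension {s : Set ℝ} (hs : Convex ℝ s) (hu : UniqueDiffOn ℝ s)
    {r : ℝ → ℝ} (hr : Continuous r) (hrs : ∀ x, r x ∈ s) (hid : ∀ x ∈ s, r x = x)
    (h0 : (0 : ℝ) ∈ s) {f : ℝ → ℝ} (hf : ContDiffOn ℝ 2 f s) :
    ∃ g g' g'' : ℝ → ℝ, IsC2 g g' g'' ∧ EqOn f g s := by
  have e : (2 : WithTop ℕ∞) = 1 + 1 := by norm_num
  have h1 : ContDiffOn ℝ 1 (derivWithin f s) s := by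
    rw [e, contDiffOn_succ_iff_derivWithin hu] at hf
    exact hf.2.2
  have hd0 : DifferentiableOn ℝ f s := hf.differentiableOn (by norm_num)
  have hd1 : DifferentiableOn ℝ (derivWithin f s) s := h1.differentiableOn (by norm_num)
  have hc : ContinuousOn (derivWithin (derivWithin f s) s) s :=
    h1.continuousOn_derivWithin hu le_rfl
  -- The second derivative is extended continuously by the retraction `r` onto `s`; integrating it
  -- twice from `0` gives the extension.
  set g'' : ℝ → ℝ := fun x => derivWithin (derivWithin f s) s (r x) with hg''
  have hg''c : Continuous g'' := hc.comp_continuous hr hrs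
  -- On a convex set a function with zero derivative is constant, so `F` is recovered from `F 0` and
  -- the integral of its derivative. This is used once for the first derivative and once for `f`.
  have key : ∀ (F G : ℝ → ℝ), Continuous G → DifferentiableOn ℝ F s →
      (∀ x ∈ s, derivWithin F s x = G x) →
      (∀ x, HasDerivAt (fun y => F 0 + ∫ t in (0 : ℝ)..y, G t) (G x) x) ∧
      EqOn F (fun y => F 0 + ∫ t in (0 : ℝ)..y, G t) s := by
    intro F G hG hF hFG
    have hI : ∀ x, HasDerivAt (fun y => F 0 + ∫ t in (0 : ℝ)..y, G t) (G x) x := fun x =>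
      ((integral_hasDerivAt_right (hG.intervalIntegrable _ _)
        (hG.stronglyMeasurableAtFilter _ _) hG.continuousAt).const_add _)
    refine ⟨hI, ?_⟩
    have : EqOn (fun y => F y - (F 0 + ∫ t in (0 : ℝ)..y, G t)) (fun _ => 0) s := by
      intro x hx
      have hd : ∀ y ∈ s, HasDerivWithinAt (fun y => F y - (F 0 + ∫ t in (0 : ℝ)..y, G t)) 0 s y := by
        intro y hy
        have := (hF y hy).hasDerivWithinAt.sub (hI y).hasDerivWithinAt (s := s)
        rw [hFG y hy, sub_self] at this
        exact this
      have h2 := hs.is_const_of_fderivWithin_eq_zero (𝕜 := ℝ)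
        (f := fun y => F y - (F 0 + ∫ t in (0 : ℝ)..y, G t))
        (fun y hy => (hd y hy).differentiableWithinAt) (fun y hy => ?_) hx h0
      · simpa using h2
      · have := (hd y hy).hasFDerivWithinAt.fderivWithin (hu y hy)
        rw [this]; ext; simp
    intro x hx
    have := this hx
    simp only at this ⊢
    linarith
  obtain ⟨ha, hb⟩ := key (derivWithin f s) g'' hg''c hd1 (fun x hx => by simp [hg'', hid x hx])
  have hg'c : Continuous (fun y => derivWithin f s 0 + ∫ t in (0 : ℝ)..y, g'' t) :=
    continuous_iff_continuousAt.2 fun x => (ha x).continuousAt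
  obtain ⟨hc', hd'⟩ := key f _ hg'c hd0 hb
  exact ⟨_, _, g'', ⟨hc', ha, hg''c⟩, hd'⟩

theorem exists_isC2_extension_Icc {f : ℝ → ℝ} (hf : ContDiffOn ℝ 2 f (Icc 0 1)) :
    ∃ g g' g'' : ℝ → ℝ, IsC2 g g' g'' ∧ EqOn f g (Icc 0 1) :=
  exists_isC2_extension (r := fun x => max 0 (min 1 x)) (convex_Icc 0 1)
    (uniqueDiffOn_Icc zero_lt_one) (by fun_prop) (fun x => ⟨le_max_left _ _, by simp⟩)
    (fun x hx => by simp [hx.1, hx.2]) (by simp) hf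

theorem exists_isC2_extension_Ici {f : ℝ → ℝ} (hf : ContDiffOn ℝ 2 f (Ici 0)) :
    ∃ g g' g'' : ℝ → ℝ, IsC2 g g' g'' ∧ EqOn f g (Ici 0) :=
  exists_isC2_extension (r := fun x => max 0 x) (convex_Ici 0)
    (uniqueDiffOn_Ici 0) (by fun_prop) (fun x => by simp)
    (fun x hx => by simpa using hx) (by simp) hf

/-! ### The exit condition without drift -/

/-- The exit condition at `z = 1` for a profile with value `p` and slope `p'` there, once the
drift has been removed. -/
def ExitBC (a : ℝ≥0∞) (p p' : ℝ) : Prop :=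
  (a = ⊤ → p = 0) ∧ (a ≠ ⊤ → p' = -a.toReal * p)

namespace ExitBC

variable {a : ℝ≥0∞} {p p' q q' : ℝ}

theorem add (hp : ExitBC a p p') (hq : ExitBC a q q') : ExitBC a (p + q) (p' + q') :=
  ⟨fun h => by rw [hp.1 h, hq.1 h, add_zero], fun h => by rw [hp.2 h, hq.2 h]; ring⟩

theorem const_mul (hp : ExitBC a p p') (c : ℝ) : ExitBC a (c * p) (c * p') :=
  ⟨fun h => by rw [hp.1 h, mul_zero], fun h => by rw [hp.2 h]; ring⟩

theorem sub (hp : ExitBC a p p') (hq : ExitBC a q q') : ExitBC a (p - q) (p' - q') :=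
  ⟨fun h => by rw [hp.1 h, hq.1 h, sub_zero], fun h => by rw [hp.2 h, hq.2 h]; ring⟩

/-- Makes the exit condition self-adjoint: the boundary terms at `z = 1` in Green's identity cancel.
-/
theorem wronskian_eq_zero (hp : ExitBC a p p') (hq : ExitBC a q q') : p' * q - p * q' = 0 := by
  by_cases h : a = ⊤
  · rw [hp.1 h, hq.1 h]; ring
  · rw [hp.2 h, hq.2 h]; ring

end ExitBC

/-! ### Poincaré inequality for positive parts -/

/-- The square of the positive part has no corner, so the energy of a positive part can be
differentiated in time without smoothing. -/
theorem hasDerivAt_max_zero_sq (x : ℝ) :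
    HasDerivAt (fun x : ℝ => max x 0 ^ 2) (2 * max x 0) x := by
  rcases lt_trichotomy x 0 with h | h | h
  · have : (fun x : ℝ => max x 0 ^ 2) =ᶠ[𝓝 x] fun _ => 0 := by
      filter_upwards [Iio_mem_nhds h] with y hy
      simp [max_eq_right (le_of_lt (mem_Iio.1 hy))]
    rw [max_eq_right h.le, mul_zero]
    exact (hasDerivAt_const x (0 : ℝ)).congr_of_eventuallyEq this
  · subst h
    rw [max_self, mul_zero, hasDerivAt_iff_isLittleO]
    simp only [max_self, sub_zero, smul_zero]
    refine Asymptotics.IsBigO.trans_isLittleO (g := fun x : ℝ => x ^ 2) ?_ ?_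
    · refine Asymptotics.IsBigO.of_bound 1 (Eventually.of_forall fun y => ?_)
      rcases le_total y 0 with hy | hy
      · simp [max_eq_right hy, sq_nonneg]
      · simp [max_eq_left hy]
    · exact Asymptotics.isLittleO_pow_id one_lt_two
  · have : (fun x : ℝ => max x 0 ^ 2) =ᶠ[𝓝 x] fun x => x ^ 2 := by
      filter_upwards [Ioi_mem_nhds h] with y hy
      simp [max_eq_left (le_of_lt (mem_Ioi.1 hy))]
    rw [max_eq_left h.le]
    exact (hasDerivAt_pow 2 x).congr_of_eventuallyEq this |>.congr_deriv (by simp)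

/-- A smooth nondecreasing approximation of the positive part. -/
theorem hasDerivAt_smoothPos {δ : ℝ} (hδ : 0 < δ) (x : ℝ) :
    HasDerivAt (fun x : ℝ => Real.sqrt (max x 0 ^ 2 + δ ^ 2) - δ)
      (max x 0 / Real.sqrt (max x 0 ^ 2 + δ ^ 2)) x := by
  have hpos : 0 < max x 0 ^ 2 + δ ^ 2 := by positivity
  refine ((((hasDerivAt_max_zero_sq x).add_const (δ ^ 2)).sqrt hpos.ne').sub_const δ).congr_deriv ?_
  have := (Real.sqrt_pos.2 hpos).ne'
  field_simp

theorem abs_smoothPos_sub_le {δ : ℝ} (hδ : 0 < δ) (x : ℝ) :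
    |Real.sqrt (max x 0 ^ 2 + δ ^ 2) - δ - max x 0| ≤ δ := by
  have hm : 0 ≤ max x 0 := le_max_right _ _
  have h1 : max x 0 ≤ Real.sqrt (max x 0 ^ 2 + δ ^ 2) :=
    Real.le_sqrt_of_sq_le (by nlinarith)
  have h2 : Real.sqrt (max x 0 ^ 2 + δ ^ 2) ≤ max x 0 + δ := by
    rw [Real.sqrt_le_left (by positivity)]
    nlinarith
  rw [abs_le]
  constructor <;> linarith

/-- Jacobi's form of the Poincaré inequality, tested against the positive part. -/
theorem integral_posPart_mul_nonpos {f f' f'' φ φ' φ'' : ℝ → ℝ} {κ : ℝ} (hf : IsC2 f f' f'')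
    (hφ : IsC2 φ φ' φ'') (hφκ : ∀ z, φ'' z = -κ ^ 2 * φ z) (hpos : ∀ z ∈ Icc (0 : ℝ) 1, 0 < φ z)
    (h0 : f 0 ≤ 0) (h1 : 0 < f 1 → f' 1 * φ 1 ≤ f 1 * φ' 1) :
    ∫ z in (0 : ℝ)..1, max (f z) 0 * (f'' z + κ ^ 2 * f z) ≤ 0 := by
  -- `W` is the Wronskian of `φ` and `f`. It satisfies `W' = φ (f'' + κ² f)`, and the quotient `p =
  -- f / φ` has derivative `W / φ²`, so the integrand is `max p 0 * W'`.
  set W : ℝ → ℝ := fun z => φ z * f' z - φ' z * f z with hW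
  set W' : ℝ → ℝ := fun z => φ z * (f'' z + κ ^ 2 * f z) with hW'
  have hWd : ∀ z, HasDerivAt W (W' z) z := fun z =>
    (((hφ.hasDerivAt z).mul (hf.hasDerivAt' z)).sub
      ((hφ.hasDerivAt' z).mul (hf.hasDerivAt z))).congr_deriv (by rw [hφκ]; simp only [hW']; ring)
  have hWc : Continuous W := continuous_iff_continuousAt.2 fun x => (hWd x).continuousAt
  have hfc := hf.continuous
  have hφc := hφ.continuous
  have hf''c := hf.continuous''
  have hW'c : Continuous W' := by fun_prop
  set p : ℝ → ℝ := fun z => f z / φ z with hp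
  have huIcc : uIcc (0 : ℝ) 1 = Icc 0 1 := uIcc_of_le zero_le_one
  have hpd : ∀ z ∈ Icc (0 : ℝ) 1, HasDerivAt p (W z / φ z ^ 2) z := fun z hz =>
    ((hf.hasDerivAt z).div (hφ.hasDerivAt z) (hpos z hz).ne').congr_deriv (by
      simp only [hW]; ring)
  have hpc : ContinuousOn p (Icc 0 1) := fun z hz => (hpd z hz).continuousAt.continuousWithinAt
  have hmax : ∀ z ∈ Icc (0 : ℝ) 1, max (f z) 0 * (f'' z + κ ^ 2 * f z) = max (p z) 0 * W' z := by
    intro z hz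
    have hz' := hpos z hz
    have : max (f z) 0 = max (p z) 0 * φ z := by
      rw [max_mul_of_nonneg _ _ hz'.le, zero_mul, hp]
      simp only
      rw [div_mul_cancel₀ _ hz'.ne']
    rw [this]; simp only [hW']; ring
  have hcongr : ∫ z in (0 : ℝ)..1, max (f z) 0 * (f'' z + κ ^ 2 * f z) =
      ∫ z in (0 : ℝ)..1, max (p z) 0 * W' z :=
    integral_congr fun z hz => hmax z (huIcc ▸ hz)
  rw [hcongr]
  have hpmc : ContinuousOn (fun z => max (p z) 0) (Icc 0 1) := hpc.sup continuousOn_const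
  have hint1 : IntervalIntegrable (fun z => max (p z) 0 * W' z) volume 0 1 :=
    ContinuousOn.intervalIntegrable (by rw [huIcc]; exact hpmc.mul hW'c.continuousOn)
  -- Formally `∫ p⁺ W' = [p⁺ W] - ∫_{p > 0} W² / φ² ≤ 0`. The positive part has a corner at `0`, so
  -- it is replaced by the smooth `η`, at a cost of `δ ∫ |W'|`.
  have key : ∀ δ : ℝ, 0 < δ →
      ∫ z in (0 : ℝ)..1, max (p z) 0 * W' z ≤ δ * ∫ z in (0 : ℝ)..1, |W' z| := by
    intro δ hδ
    set η : ℝ → ℝ := fun x => Real.sqrt (max x 0 ^ 2 + δ ^ 2) - δ with hη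
    set η' : ℝ → ℝ := fun x => max x 0 / Real.sqrt (max x 0 ^ 2 + δ ^ 2) with hη'
    have hηc : Continuous η := by fun_prop
    have hη'c : Continuous η' := by
      refine Continuous.div (by fun_prop) (by fun_prop) fun x => ?_
      have hpos : 0 < max x 0 ^ 2 + δ ^ 2 := by positivity
      exact (Real.sqrt_pos.2 hpos).ne'
    have hη'n : ∀ x, 0 ≤ η' x := fun x => by positivity
    have hηp : ∀ z ∈ Icc (0 : ℝ) 1, HasDerivAt (fun z => η (p z)) (η' (p z) * (W z / φ z ^ 2)) z :=
      fun z hz => (hasDerivAt_smoothPos hδ (p z)).comp z (hpd z hz)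
    have hcd : ContinuousOn (fun z => η' (p z) * (W z / φ z ^ 2)) (Icc 0 1) :=
      (hη'c.comp_continuousOn hpc).mul (hWc.continuousOn.div (hφc.continuousOn.pow 2)
        fun z hz => pow_ne_zero _ (hpos z hz).ne')
    have hparts := integral_mul_deriv_eq_deriv_mul (a := 0) (b := 1) (u := fun z => η (p z))
      (v := W) (u' := fun z => η' (p z) * (W z / φ z ^ 2)) (v' := W')
      (fun z hz => hηp z (huIcc ▸ hz)) (fun z _ => hWd z)
      (ContinuousOn.intervalIntegrable (by rwa [huIcc])) (hW'c.intervalIntegrable _ _)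
    have hη0 : η (p 0) = 0 := by
      have : max (p 0) 0 = 0 := max_eq_right
        (div_nonpos_of_nonpos_of_nonneg h0 (hpos 0 (by simp)).le)
      simp only [hη, this]
      rw [zero_pow two_ne_zero, zero_add, Real.sqrt_sq hδ.le, sub_self]
    -- At the exit either `η` vanishes or `f 1 > 0`, and then `h1` says that the Wronskian is
    -- nonpositive.
    have hη1 : η (p 1) * W 1 ≤ 0 := by
      rcases le_or_gt (f 1) 0 with h | h
      · have : max (p 1) 0 = 0 := max_eq_right
          (div_nonpos_of_nonpos_of_nonneg h (hpos 1 (by simp)).le)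
        simp only [hη, this]
        rw [zero_pow two_ne_zero, zero_add, Real.sqrt_sq hδ.le, sub_self, zero_mul]
      · refine mul_nonpos_of_nonneg_of_nonpos ?_ ?_
        · simp only [hη, sub_nonneg]
          exact Real.le_sqrt_of_sq_le (by nlinarith [sq_nonneg (max (p 1) 0)])
        · simp only [hW]; nlinarith [h1 h]
    have hnn : 0 ≤ ∫ z in (0 : ℝ)..1, η' (p z) * (W z / φ z ^ 2) * W z := by
      refine integral_nonneg zero_le_one fun z hz => ?_
      have : η' (p z) * (W z / φ z ^ 2) * W z = η' (p z) * (W z ^ 2 / φ z ^ 2) := by ring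
      rw [this]
      exact mul_nonneg (hη'n _) (by positivity)
    have hηle : ∫ z in (0 : ℝ)..1, η (p z) * W' z ≤ 0 := by
      rw [hparts, hη0]; linarith
    have hint2 : IntervalIntegrable (fun z => η (p z) * W' z) volume 0 1 :=
      ContinuousOn.intervalIntegrable (by
        rw [huIcc]; exact (hηc.comp_continuousOn hpc).mul hW'c.continuousOn)
    have : ∫ z in (0 : ℝ)..1, (max (p z) 0 * W' z - η (p z) * W' z) ≤
        ∫ z in (0 : ℝ)..1, δ * |W' z| := by
      refine integral_mono_on zero_le_one (hint1.sub hint2)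
        ((hW'c.abs.const_mul δ).intervalIntegrable _ _) fun z _ => ?_
      have h := abs_smoothPos_sub_le hδ (p z)
      calc max (p z) 0 * W' z - η (p z) * W' z = -((η (p z) - max (p z) 0) * W' z) := by ring
        _ ≤ |(η (p z) - max (p z) 0) * W' z| := neg_le_abs _
        _ = |η (p z) - max (p z) 0| * |W' z| := abs_mul _ _
        _ ≤ δ * |W' z| := by gcongr
    rw [integral_sub hint1 hint2, intervalIntegral.integral_const_mul] at this
    linarith
  have hlim : Tendsto (fun δ : ℝ => δ * ∫ z in (0 : ℝ)..1, |W' z|) (𝓝[>] 0) (𝓝 0) := by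
    have : Tendsto (fun δ : ℝ => δ * ∫ z in (0 : ℝ)..1, |W' z|) (𝓝 0)
        (𝓝 (0 * ∫ z in (0 : ℝ)..1, |W' z|)) := Continuous.tendsto (by fun_prop) 0
    rw [zero_mul] at this
    exact this.mono_left nhdsWithin_le_nhds
  exact ge_of_tendsto hlim (by filter_upwards [self_mem_nhdsWithin] with δ hδ using key δ hδ)

/-! ### Eigenfrequencies and the sharp rate -/

theorem mu_nonneg (a : ℝ≥0∞) {n : ℕ} (hn : 1 ≤ n) : 0 ≤ mu n a := by
  by_cases htop : a = ⊤
  · simp [mu, htop]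
  by_cases h0 : a = 0
  · simp [mu, h0]
  exact (isMuRoot_mu h0 htop hn).1.1.le

theorem mu_le_half (a : ℝ≥0∞) {n : ℕ} (hn : 1 ≤ n) : mu n a ≤ 1 / 2 := by
  by_cases htop : a = ⊤
  · simp [mu, htop]
  by_cases h0 : a = 0
  · simp [mu, h0]
  exact (isMuRoot_mu h0 htop hn).1.2.le

theorem mu_pos {a : ℝ≥0∞} (htop : a ≠ ⊤) {n : ℕ} (hn : 1 ≤ n) : 0 < mu n a := by
  by_cases h0 : a = 0
  · simp [mu, h0]
  exact (isMuRoot_mu h0 htop hn).1.1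

theorem mu_top (n : ℕ) : mu n ⊤ = 0 := by simp [mu]

/-- The spatial frequency `ω_n = (n + 1 - μ_{n+1}(a)) π` of the `n`-th eigenfunction
`sin (ω_n z)`, `n ≥ 0`. -/
noncomputable def freq (a : ℝ≥0∞) (n : ℕ) : ℝ := ((n + 1 : ℕ) - mu (n + 1) a) * Real.pi

theorem freq_lower (a : ℝ≥0∞) (n : ℕ) : (n + 1 / 2) * Real.pi ≤ freq a n := by
  have h := mu_le_half a (Nat.le_add_left 1 n)
  unfold freq
  push_cast
  have := Real.pi_pos
  gcongr
  linarith

theorem freq_upper (a : ℝ≥0∞) (n : ℕ) : freq a n ≤ (n + 1) * Real.pi := by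
  have h := mu_nonneg a (Nat.le_add_left 1 n)
  unfold freq
  push_cast
  have := Real.pi_pos
  gcongr
  linarith

theorem freq_lt {a : ℝ≥0∞} (ha : a ≠ ⊤) (n : ℕ) : freq a n < (n + 1) * Real.pi := by
  have h := mu_pos ha (Nat.le_add_left 1 n)
  unfold freq
  push_cast
  have := Real.pi_pos
  gcongr
  linarith

theorem freq_pos (a : ℝ≥0∞) (n : ℕ) : 0 < freq a n :=
  lt_of_lt_of_le (by have := Real.pi_pos; positivity) (freq_lower a n)

theorem succ_le_freq (a : ℝ≥0∞) (n : ℕ) : (n : ℝ) + 1 ≤ freq a n := by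
  have h := freq_lower a n
  have hn : (0 : ℝ) ≤ n := n.cast_nonneg
  nlinarith [Real.pi_gt_three]

theorem freq_strictMono (a : ℝ≥0∞) : StrictMono (freq a) := by
  refine strictMono_nat_of_lt_succ fun n => ?_
  have h1 := freq_upper a n
  have h2 := freq_lower a (n + 1)
  push_cast at h2
  nlinarith [Real.pi_pos]

/-- With `ω = nπ - μπ`, the condition `ω cos ω = -a sin ω` is `(n - μ) π cos μπ = a sin μπ`. This is
the equation that defines `μ_n`. -/
theorem exitBC_freq (a : ℝ≥0∞) (n : ℕ) :
    ExitBC a (Real.sin (freq a n)) (freq a n * Real.cos (freq a n)) := by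
  have hs : freq a n = ((n + 1 : ℕ) : ℝ) * Real.pi - mu (n + 1) a * Real.pi := by
    unfold freq; ring
  refine ⟨fun h => ?_, fun h => ?_⟩
  · rw [hs, h, mu_top, zero_mul, sub_zero, Real.sin_nat_mul_pi]
  · by_cases h0 : a = 0
    · have hm : mu (n + 1) a = 1 / 2 := by simp [mu, h0]
      have : Real.cos (freq a n) = 0 := by
        rw [hs, hm, Real.cos_nat_mul_pi_sub]
        have : (1 / 2 : ℝ) * Real.pi = Real.pi / 2 := by ring
        rw [this, Real.cos_pi_div_two, mul_zero]
      rw [this, h0]; simp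
    · have hr := isMuRoot_mu h0 h (Nat.le_add_left 1 n)
      have ha : 0 < a.toReal := ENNReal.toReal_pos h0 h
      have hc : 0 < Real.cos (mu (n + 1) a * Real.pi) :=
        Real.cos_pos_of_mem_Ioo ⟨by nlinarith [hr.1.1, Real.pi_pos],
          by nlinarith [hr.1.2, Real.pi_pos]⟩
      have h2 := hr.2
      rw [Real.tan_eq_sin_div_cos] at h2
      field_simp at h2
      have h3 : freq a n * Real.cos (mu (n + 1) a * Real.pi) =
          a.toReal * Real.sin (mu (n + 1) a * Real.pi) := by
        unfold freq
        linarith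
      have e1 : Real.cos (freq a n) =
          (-1) ^ (n + 1) * Real.cos (mu (n + 1) a * Real.pi) := by
        rw [hs, Real.cos_nat_mul_pi_sub]
      have e2 : Real.sin (freq a n) =
          -((-1) ^ (n + 1) * Real.sin (mu (n + 1) a * Real.pi)) := by
        rw [hs, Real.sin_nat_mul_pi_sub]
      rw [e1, e2]
      linear_combination (-1) ^ (n + 1) * h3

/-- The first eigenfunction vanishes at the inlet, so it cannot serve as the positive `φ` on `[0,
1]`. A phase shift that keeps the sine positive is available for each `κ < ω_0`, and then `κ → ω_0`.
-/
theorem integral_posPart_mul_deriv_le {a : ℝ≥0∞} {f f' f'' : ℝ → ℝ} (hf : IsC2 f f' f'')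
    (h0 : f 0 ≤ 0) (h1 : ExitBC a (f 1) (f' 1)) :
    ∫ z in (0 : ℝ)..1, max (f z) 0 * f'' z ≤
      -freq a 0 ^ 2 * ∫ z in (0 : ℝ)..1, max (f z) 0 ^ 2 := by
  have hfc := hf.continuous
  have hf''c := hf.continuous''
  have hlow : Real.pi / 2 ≤ freq a 0 := by have := freq_lower a 0; push_cast at this; linarith
  have hup : freq a 0 ≤ Real.pi := by have := freq_upper a 0; push_cast at this; linarith
  have hpi := Real.pi_pos
  have key : ∀ κ ∈ Ioo 0 (freq a 0), ∫ z in (0 : ℝ)..1, max (f z) 0 * f'' z ≤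
      -κ ^ 2 * ∫ z in (0 : ℝ)..1, max (f z) 0 ^ 2 := by
    intro κ hκ
    have h : ∫ z in (0 : ℝ)..1, max (f z) 0 * (f'' z + κ ^ 2 * f z) ≤ 0 := by
      by_cases ha : a = ⊤
      -- For Dirichlet exit the phase centres the arch of the sine on `[0, 1]`, which fits because
      -- `κ < π`.
      · refine integral_posPart_mul_nonpos hf (isC2_sin ((Real.pi - κ) / 2) κ) (fun z => rfl)
          (fun z hz => ?_) h0 (fun h => absurd (h1.1 ha) h.ne')
        exact Real.sin_pos_of_mem_Ioo ⟨by nlinarith [hκ.1, hκ.2, hz.1],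
          by nlinarith [hκ.1, hκ.2, hz.2]⟩
      -- This phase makes the argument equal to `ω_0` at `z = 1`. There `φ' / φ = κ cot ω_0 ≥ ω_0
      -- cot ω_0 = -a`, because `ω_0 ∈ [π/2, π)` makes the cotangent nonpositive.
      · refine integral_posPart_mul_nonpos hf (isC2_sin (freq a 0 - κ) κ) (fun z => rfl)
          (fun z hz => ?_) h0 (fun h => ?_)
        · have hlt : freq a 0 < Real.pi := by
            have := freq_lt ha 0; push_cast at this; linarith
          exact Real.sin_pos_of_mem_Ioo ⟨by nlinarith [hκ.1, hκ.2, hz.1],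
            by nlinarith [hκ.1, hκ.2, hz.2]⟩
        · have e : freq a 0 - κ + κ * 1 = freq a 0 := by ring
          simp only [e]
          rw [h1.2 ha]
          have h2 := (exitBC_freq a 0).2 ha
          have hcos : Real.cos (freq a 0) ≤ 0 :=
            Real.cos_nonpos_of_pi_div_two_le_of_le hlow (by linarith)
          have : -a.toReal * f 1 * Real.sin (freq a 0) =
              f 1 * (freq a 0 * Real.cos (freq a 0)) := by rw [h2]; ring
          rw [this]
          refine mul_le_mul_of_nonneg_left ?_ h.le
          nlinarith [hκ.2]
    have e : ∀ z, max (f z) 0 * (f'' z + κ ^ 2 * f z) =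
        max (f z) 0 * f'' z + κ ^ 2 * max (f z) 0 ^ 2 := by
      intro z
      rcases le_total (f z) 0 with h | h
      · simp [max_eq_right h]
      · rw [max_eq_left h]; ring
    simp only [e] at h
    rw [integral_add (Continuous.intervalIntegrable (by fun_prop) _ _)
      (Continuous.intervalIntegrable (by fun_prop) _ _),
      intervalIntegral.integral_const_mul] at h
    linarith
  have hlim : Tendsto (fun κ : ℝ => -κ ^ 2 * ∫ z in (0 : ℝ)..1, max (f z) 0 ^ 2)
      (𝓝[<] (freq a 0)) (𝓝 (-freq a 0 ^ 2 * ∫ z in (0 : ℝ)..1, max (f z) 0 ^ 2)) :=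
    (Continuous.tendsto (by fun_prop) _).mono_left nhdsWithin_le_nhds
  refine ge_of_tendsto hlim ?_
  filter_upwards [Ioo_mem_nhdsLT (freq_pos a 0)] with κ hκ using key κ hκ

/-! ### Energy decay for the equation without drift -/

/-- Classical solutions of `u_t = D (u_zz - ζ² u)` on `[0, ∞) × [0, 1]` with inlet value `d`,
exit parameter `a` and time derivative `r`. -/
structure HeatSol (D ζ : ℝ) (a : ℝ≥0∞) (d : ℝ → ℝ) (u r : ℝ → ℝ → ℝ) : Prop where
  continuousOn : ContinuousOn (fun q : ℝ × ℝ => u q.1 q.2) (Ici 0 ×ˢ Icc 0 1)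
  continuousOn_deriv : ContinuousOn (fun q : ℝ × ℝ => r q.1 q.2) (Ioi 0 ×ˢ Icc 0 1)
  hasDerivAt : ∀ t, 0 < t → ∀ z ∈ Icc (0 : ℝ) 1, HasDerivAt (fun s => u s z) (r t z) t
  inlet : ∀ t, 0 ≤ t → u t 0 = d t
  profile : ∀ t, 0 < t → ∃ f f' f'' : ℝ → ℝ, IsC2 f f' f'' ∧ (∀ z ∈ Icc (0 : ℝ) 1, u t z = f z) ∧
    (∀ z ∈ Ioo (0 : ℝ) 1, r t z = D * (f'' z - ζ ^ 2 * f z)) ∧ ExitBC a (f 1) (f' 1)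

namespace HeatSol

variable {D ζ : ℝ} {a : ℝ≥0∞} {d e : ℝ → ℝ} {u v r s : ℝ → ℝ → ℝ}

theorem sub (hu : HeatSol D ζ a d u r) (hv : HeatSol D ζ a e v s) :
    HeatSol D ζ a (fun t => d t - e t) (fun t z => u t z - v t z) (fun t z => r t z - s t z) where
  continuousOn := hu.continuousOn.sub hv.continuousOn
  continuousOn_deriv := hu.continuousOn_deriv.sub hv.continuousOn_deriv
  hasDerivAt t ht z hz := (hu.hasDerivAt t ht z hz).sub (hv.hasDerivAt t ht z hz)
  inlet t ht := by rw [hu.inlet t ht, hv.inlet t ht]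
  profile t ht := by
    obtain ⟨f, f', f'', h1, h2, h3, h4⟩ := hu.profile t ht
    obtain ⟨g, g', g'', k1, k2, k3, k4⟩ := hv.profile t ht
    refine ⟨_, _, _, h1.sub k1, fun z hz => ?_, fun z hz => ?_, h4.sub k4⟩
    · rw [h2 z hz, k2 z hz]
    · rw [h3 z hz, k3 z hz]; ring

theorem zero : HeatSol D ζ a (fun _ => 0) (fun _ _ => 0) (fun _ _ => 0) where
  continuousOn := continuousOn_const
  continuousOn_deriv := continuousOn_const
  hasDerivAt t _ z _ := hasDerivAt_const t (0 : ℝ)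
  inlet t _ := rfl
  profile t _ := ⟨fun _ => 0, fun _ => 0, fun _ => 0,
    ⟨fun x => hasDerivAt_const x (0 : ℝ), fun x => hasDerivAt_const x (0 : ℝ), continuous_const⟩,
    fun _ _ => rfl, fun _ _ => by simp, ⟨fun _ => rfl, fun _ => by simp⟩⟩

theorem steady {f f' f'' : ℝ → ℝ} (hf : IsC2 f f' f'') (hζ : ∀ z, f'' z = ζ ^ 2 * f z)
    (h1 : ExitBC a (f 1) (f' 1)) (D : ℝ) :
    HeatSol D ζ a (fun _ => f 0) (fun _ z => f z) (fun _ _ => 0) where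
  continuousOn := (hf.continuous.comp continuous_snd).continuousOn
  continuousOn_deriv := continuousOn_const
  hasDerivAt t _ z _ := hasDerivAt_const t _
  inlet t _ := rfl
  profile t _ := ⟨f, f', f'', hf, fun _ _ => rfl, fun z _ => by rw [hζ, sub_self, mul_zero], h1⟩

/-- Clamping both variables to the strip gives a globally continuous function, as needed for
continuity of the energy down to `t = 0`. -/
theorem continuous_clamp (hu : HeatSol D ζ a d u r) :
    Continuous (fun q : ℝ × ℝ => u (max 0 q.1) (max 0 (min 1 q.2))) :=
  hu.continuousOn.comp_continuous (f := fun q : ℝ × ℝ => (max 0 q.1, max 0 (min 1 q.2)))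
    (by fun_prop) fun q => ⟨by simp, by simp⟩

theorem continuousOn_slice (hu : HeatSol D ζ a d u r) {t : ℝ} (ht : 0 ≤ t) :
    ContinuousOn (u t) (Icc 0 1) :=
  hu.continuousOn.comp (f := fun z => (t, z)) (by fun_prop) fun z hz => ⟨ht, hz⟩

theorem hasDerivAt_energy (hu : HeatSol D ζ a d u r) {t : ℝ} (ht : 0 < t) :
    HasDerivAt (fun t => ∫ z in (0 : ℝ)..1, max (u t z) 0 ^ 2)
      (∫ z in (0 : ℝ)..1, 2 * max (u t z) 0 * r t z) t := by
  have hIoc : uIoc (0 : ℝ) 1 ⊆ Icc 0 1 := by rw [uIoc_of_le zero_le_one]; exact Ioc_subset_Icc_self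
  have hcont : ContinuousOn (fun q : ℝ × ℝ => 2 * max (u q.1 q.2) 0 * r q.1 q.2)
      (Ioi 0 ×ˢ Icc 0 1) :=
    (((hu.continuousOn.mono (prod_mono_left Ioi_subset_Ici_self)).sup
      continuousOn_const).const_mul 2).mul hu.continuousOn_deriv
  -- The window `[t/2, 2t]` stays away from `t = 0`, where nothing is assumed about the time
  -- derivative.
  have hK : IsCompact (Icc (t / 2) (2 * t) ×ˢ Icc (0 : ℝ) 1) := isCompact_Icc.prod isCompact_Icc
  have hKsub : Icc (t / 2) (2 * t) ×ˢ Icc (0 : ℝ) 1 ⊆ Ioi 0 ×ˢ Icc 0 1 :=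
    prod_mono_left fun s hs => lt_of_lt_of_le (by positivity) hs.1
  obtain ⟨C, hC⟩ := hK.exists_bound_of_continuousOn (hcont.mono hKsub)
  have hslice : ∀ s, 0 ≤ s → ContinuousOn (fun z => max (u s z) 0 ^ 2) (Icc 0 1) := fun s hs =>
    ((hu.continuousOn_slice hs).sup continuousOn_const).pow 2
  refine (intervalIntegral.hasDerivAt_integral_of_dominated_loc_of_deriv_le (s := Icc (t / 2) (2 * t))
    (bound := fun _ => C) (F := fun t z => max (u t z) 0 ^ 2)
    (F' := fun t z => 2 * max (u t z) 0 * r t z)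
    (Icc_mem_nhds (by linarith) (by linarith)) ?_ ?_ ?_ ?_ ?_ ?_).2
  · filter_upwards [Ioi_mem_nhds ht] with s hs
    exact ((hslice s (le_of_lt hs)).mono hIoc).aestronglyMeasurable measurableSet_uIoc
  · exact ContinuousOn.intervalIntegrable (by
      rw [uIcc_of_le zero_le_one]; exact hslice t ht.le)
  · refine ContinuousOn.aestronglyMeasurable ?_ measurableSet_uIoc
    exact hcont.comp (f := fun z => (t, z)) (by fun_prop) fun z hz => ⟨ht, hIoc hz⟩
  · exact Eventually.of_forall fun z hz s hs => hC (s, z) ⟨hs, hIoc hz⟩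
  · exact continuous_const.intervalIntegrable _ _
  · refine Eventually.of_forall fun z hz s hs => ?_
    exact (hasDerivAt_max_zero_sq (u s z)).comp s (hu.hasDerivAt s
      (lt_of_lt_of_le (by positivity) hs.1) z (hIoc hz))

theorem integral_energy_deriv_le (hD : 0 < D) (hu : HeatSol D ζ a d u r) {t : ℝ} (ht : 0 < t)
    (hd : d t ≤ 0) :
    ∫ z in (0 : ℝ)..1, 2 * max (u t z) 0 * r t z ≤
      -(2 * (D * (ζ ^ 2 + freq a 0 ^ 2))) * ∫ z in (0 : ℝ)..1, max (u t z) 0 ^ 2 := by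
  obtain ⟨f, f', f'', hf, h2, h3, h4⟩ := hu.profile t ht
  have hf0 : f 0 ≤ 0 := by rw [← h2 0 (by simp), hu.inlet t ht.le]; exact hd
  have key := integral_posPart_mul_deriv_le hf hf0 h4
  have hfc := hf.continuous
  have hf''c := hf.continuous''
  have e1 : ∫ z in (0 : ℝ)..1, max (u t z) 0 ^ 2 = ∫ z in (0 : ℝ)..1, max (f z) 0 ^ 2 := by
    refine integral_congr fun z hz => ?_
    rw [uIcc_of_le zero_le_one] at hz
    simp only [h2 z hz]
  have e2 : ∫ z in (0 : ℝ)..1, 2 * max (u t z) 0 * r t z =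
      ∫ z in (0 : ℝ)..1, (2 * D * (max (f z) 0 * f'' z) - 2 * D * ζ ^ 2 * max (f z) 0 ^ 2) := by
    refine integral_congr_Ioo_of_le zero_le_one fun z hz => ?_
    rw [h2 z (Ioo_subset_Icc_self hz), h3 z hz]
    rcases le_total (f z) 0 with h | h
    · simp [max_eq_right h]
    · rw [max_eq_left h]; ring
  rw [e1, e2, integral_sub (Continuous.intervalIntegrable (by fun_prop) _ _)
      (Continuous.intervalIntegrable (by fun_prop) _ _),
      intervalIntegral.integral_const_mul, intervalIntegral.integral_const_mul]
  nlinarith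

/-- Exponential decay of the positive part of a solution with nonpositive inlet value. -/
theorem energy_le (hD : 0 < D) (hu : HeatSol D ζ a d u r) {T : ℝ} (hT : 0 ≤ T)
    (hd : ∀ t ∈ Icc 0 T, d t ≤ 0) :
    ∫ z in (0 : ℝ)..1, max (u T z) 0 ^ 2 ≤
      Real.exp (-(2 * (D * (ζ ^ 2 + freq a 0 ^ 2)) * T)) *
        ∫ z in (0 : ℝ)..1, max (u 0 z) 0 ^ 2 := by
  set l := 2 * (D * (ζ ^ 2 + freq a 0 ^ 2)) with hl
  set E : ℝ → ℝ := fun t => ∫ z in (0 : ℝ)..1, max (u t z) 0 ^ 2 with hE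
  have hEc : ContinuousOn E (Icc 0 T) := by
    have hc : Continuous fun t => ∫ z in (0 : ℝ)..1, max (u (max 0 t) (max 0 (min 1 z))) 0 ^ 2 := by
      refine continuous_parametric_intervalIntegral_of_continuous' ?_ 0 1
      exact (hu.continuous_clamp.sup continuous_const).pow 2
    refine hc.continuousOn.congr fun t ht => integral_congr fun z hz => ?_
    rw [uIcc_of_le zero_le_one] at hz
    simp only [max_eq_right ht.1, min_eq_right hz.2, max_eq_right hz.1]
  -- Grönwall's argument: the differential inequality says that `exp (l t) E(t)` does not increase.
  have hanti : AntitoneOn (fun t => Real.exp (l * t) * E t) (Icc 0 T) := by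
    have hd' : ∀ t, 0 < t → HasDerivAt (fun t => Real.exp (l * t) * E t)
        (Real.exp (l * t) * l * E t + Real.exp (l * t) *
          ∫ z in (0 : ℝ)..1, 2 * max (u t z) 0 * r t z) t := fun t ht =>
      ((((hasDerivAt_id t).const_mul l).exp).mul (hu.hasDerivAt_energy ht)).congr_deriv (by
        simp [hE])
    refine antitoneOn_of_deriv_nonpos (convex_Icc 0 T) ?_ ?_ ?_
    · exact ContinuousOn.mul (by fun_prop) hEc
    · intro t ht
      rw [interior_Icc] at ht
      exact (hd' t ht.1).differentiableAt.differentiableWithinAt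
    · intro t ht
      rw [interior_Icc] at ht
      rw [(hd' t ht.1).deriv]
      have := hu.integral_energy_deriv_le hD ht.1 (hd t (Ioo_subset_Icc_self ht))
      rw [← hl] at this
      have hexp := Real.exp_pos (l * t)
      have : Real.exp (l * t) * (l * E t + ∫ z in (0 : ℝ)..1, 2 * max (u t z) 0 * r t z) ≤ 0 :=
        mul_nonpos_of_nonneg_of_nonpos hexp.le (by linarith)
      linarith
  have h := hanti (left_mem_Icc.2 hT) (right_mem_Icc.2 hT) hT
  simp only [mul_zero, Real.exp_zero, one_mul] at h
  rw [Real.exp_neg, inv_mul_eq_div, le_div_iff₀ (Real.exp_pos _), mul_comm]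
  exact h

end HeatSol

/-! ### Comparison with the steady state -/

/-- At most one of the two positive parts is nonzero, and `|u|` is at most that part plus `c`.
Young's inequality with weight `ε` splits the square. -/
theorem sq_le_posPart {u c ε : ℝ} (hc : 0 ≤ c) (hε : 0 < ε) :
    u ^ 2 ≤ (1 + ε) * (max (u - c) 0 ^ 2 + max (0 - u - c) 0 ^ 2) + (1 + ε⁻¹) * c ^ 2 := by
  have hi : 0 < ε⁻¹ := inv_pos.2 hε
  have key : ∀ x : ℝ, (x + c) ^ 2 ≤ (1 + ε) * x ^ 2 + (1 + ε⁻¹) * c ^ 2 := by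
    intro x
    have h : (1 + ε) * x ^ 2 + (1 + ε⁻¹) * c ^ 2 - (x + c) ^ 2 = ε⁻¹ * (ε * x - c) ^ 2 := by
      field_simp
      ring
    have : 0 ≤ ε⁻¹ * (ε * x - c) ^ 2 := by positivity
    linarith
  rcases le_or_gt u c with h1 | h1
  · rcases le_or_gt (0 - u) c with h2 | h2
    · rw [max_eq_right (by linarith), max_eq_right (by linarith)]
      have : 0 ≤ ε⁻¹ * c ^ 2 := by positivity
      nlinarith
    · rw [max_eq_right (by linarith), max_eq_left (by linarith)]
      have := key (0 - u - c)
      nlinarith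
  · rw [max_eq_left (by linarith), max_eq_right (by linarith : 0 - u - c ≤ 0)]
    have := key (u - c)
    nlinarith

/-- Used at time `0`: subtracting the barrier only decreases the energy, so the initial term is
exactly the norm of the initial state. -/
theorem posPart_sq_add_le {u c : ℝ} (hc : 0 ≤ c) :
    max (u - c) 0 ^ 2 + max (0 - u - c) 0 ^ 2 ≤ u ^ 2 := by
  rcases le_or_gt u c with h1 | h1
  · rcases le_or_gt (0 - u) c with h2 | h2
    · rw [max_eq_right (by linarith), max_eq_right (by linarith)]
      nlinarith [sq_nonneg u]
    · rw [max_eq_right (by linarith), max_eq_left (by linarith)]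
      nlinarith
  · rw [max_eq_left (by linarith), max_eq_right (by linarith : 0 - u - c ≤ 0)]
    nlinarith

/-- A nonnegative steady state with inlet value `1`. -/
structure IsSteady (ζ : ℝ) (a : ℝ≥0∞) (ψ ψ' ψ'' : ℝ → ℝ) : Prop where
  isC2 : IsC2 ψ ψ' ψ''
  eq : ∀ z, ψ'' z = ζ ^ 2 * ψ z
  inlet : ψ 0 = 1
  exit : ExitBC a (ψ 1) (ψ' 1)
  nonneg : ∀ z ∈ Icc (0 : ℝ) 1, 0 ≤ ψ z

/-- The barriers `M ψ` and `-M ψ` enclose the inlet values up to time `t`; the excesses above and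
below decay separately, and their energies are added. -/
theorem HeatSol.integral_sq_le {D ζ : ℝ} {a : ℝ≥0∞} {d : ℝ → ℝ} {u r : ℝ → ℝ → ℝ}
    {ψ ψ' ψ'' : ℝ → ℝ} (hD : 0 < D) (hu : HeatSol D ζ a d u r) (hψ : IsSteady ζ a ψ ψ' ψ'')
    {t M ε : ℝ} (ht : 0 ≤ t) (hM : ∀ s ∈ Icc 0 t, |d s| ≤ M) (hε : 0 < ε) :
    ∫ z in (0 : ℝ)..1, u t z ^ 2 ≤
      (1 + ε) * (Real.exp (-(2 * (D * (ζ ^ 2 + freq a 0 ^ 2)) * t)) *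
        ∫ z in (0 : ℝ)..1, u 0 z ^ 2) + (1 + ε⁻¹) * (M ^ 2 * ∫ z in (0 : ℝ)..1, ψ z ^ 2) := by
  have hM0 : 0 ≤ M := (abs_nonneg _).trans (hM 0 ⟨le_rfl, ht⟩)
  have hst := HeatSol.steady (D := D) (hψ.isC2.const_mul M)
    (fun z => by rw [hψ.eq]; ring : ∀ z, M * ψ'' z = ζ ^ 2 * (M * ψ z)) (hψ.exit.const_mul M)
  have hψc := hψ.isC2.continuous
  have hA := (hu.sub hst).energy_le hD ht (fun s hs => by
    have := (abs_le.1 (hM s hs)).2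
    rw [hψ.inlet]; linarith)
  have hB := ((HeatSol.zero.sub hu).sub hst).energy_le hD ht (fun s hs => by
    have := (abs_le.1 (hM s hs)).1
    rw [hψ.inlet]; linarith)
  set X := Real.exp (-(2 * (D * (ζ ^ 2 + freq a 0 ^ 2)) * t)) with hX
  have hX0 : 0 ≤ X := (Real.exp_pos _).le
  have hu_ : uIcc (0 : ℝ) 1 = Icc 0 1 := uIcc_of_le zero_le_one
  have int : ∀ f : ℝ → ℝ, ContinuousOn f (Icc 0 1) → IntervalIntegrable f volume 0 1 :=
    fun f hf => ContinuousOn.intervalIntegrable (by rwa [hu_])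
  have cA : ∀ s, 0 ≤ s → ContinuousOn (fun z => max (u s z - M * ψ z) 0 ^ 2) (Icc 0 1) :=
    fun s hs => (((hu.continuousOn_slice hs).sub (by fun_prop)).sup continuousOn_const).pow 2
  have cB : ∀ s, 0 ≤ s → ContinuousOn (fun z => max (0 - u s z - M * ψ z) 0 ^ 2) (Icc 0 1) :=
    fun s hs => (((continuousOn_const.sub (hu.continuousOn_slice hs)).sub
      (by fun_prop)).sup continuousOn_const).pow 2
  have cU : ∀ s, 0 ≤ s → ContinuousOn (fun z => u s z ^ 2) (Icc 0 1) :=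
    fun s hs => (hu.continuousOn_slice hs).pow 2
  have h1 : ∫ z in (0 : ℝ)..1, u t z ^ 2 ≤ ∫ z in (0 : ℝ)..1,
      ((1 + ε) * (max (u t z - M * ψ z) 0 ^ 2 + max (0 - u t z - M * ψ z) 0 ^ 2) +
        (1 + ε⁻¹) * (M ^ 2 * ψ z ^ 2)) := by
    refine integral_mono_on zero_le_one (int _ (cU t ht)) (int _ ?_) fun z hz => ?_
    · exact ((((cA t ht).add (cB t ht)).const_mul _)).add (by fun_prop)
    · have := sq_le_posPart (u := u t z) (mul_nonneg hM0 (hψ.nonneg z hz)) hε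
      rwa [mul_pow] at this
  have cAB : ContinuousOn (fun z => (1 + ε) * (max (u t z - M * ψ z) 0 ^ 2 +
      max (0 - u t z - M * ψ z) 0 ^ 2)) (Icc 0 1) := ((cA t ht).add (cB t ht)).const_mul _
  rw [integral_add (int _ cAB) (int _ (by fun_prop)),
    intervalIntegral.integral_const_mul, intervalIntegral.integral_const_mul,
    intervalIntegral.integral_const_mul, integral_add (int _ (cA t ht)) (int _ (cB t ht))] at h1
  have h2 : (∫ z in (0 : ℝ)..1, max (u 0 z - M * ψ z) 0 ^ 2) +
      ∫ z in (0 : ℝ)..1, max (0 - u 0 z - M * ψ z) 0 ^ 2 ≤ ∫ z in (0 : ℝ)..1, u 0 z ^ 2 := by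
    rw [← integral_add (int _ (cA 0 le_rfl)) (int _ (cB 0 le_rfl))]
    exact integral_mono_on zero_le_one (int _ ((cA 0 le_rfl).add (cB 0 le_rfl)))
      (int _ (cU 0 le_rfl)) fun z hz => posPart_sq_add_le (mul_nonneg hM0 (hψ.nonneg z hz))
  have h3 := mul_le_mul_of_nonneg_left h2 hX0
  have h4 : (∫ z in (0 : ℝ)..1, max (u t z - M * ψ z) 0 ^ 2) +
      ∫ z in (0 : ℝ)..1, max (0 - u t z - M * ψ z) 0 ^ 2 ≤ X * ∫ z in (0 : ℝ)..1, u 0 z ^ 2 := by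
    linarith
  have h5 := mul_le_mul_of_nonneg_left h4 (by linarith : 0 ≤ 1 + ε)
  linarith

theorem HeatSol.sqrt_integral_sq_le {D ζ : ℝ} {a : ℝ≥0∞} {d : ℝ → ℝ} {u r : ℝ → ℝ → ℝ}
    {ψ ψ' ψ'' : ℝ → ℝ} (hD : 0 < D) (hu : HeatSol D ζ a d u r) (hψ : IsSteady ζ a ψ ψ' ψ'')
    {t M ε : ℝ} (ht : 0 ≤ t) (hM : ∀ s ∈ Icc 0 t, |d s| ≤ M) (hε : 0 < ε) :
    Real.sqrt (∫ z in (0 : ℝ)..1, u t z ^ 2) ≤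
      Real.exp (-(D * (ζ ^ 2 + freq a 0 ^ 2) * t)) *
        (Real.sqrt (1 + ε) * Real.sqrt (∫ z in (0 : ℝ)..1, u 0 z ^ 2)) +
      Real.sqrt (1 + ε⁻¹) * Real.sqrt (∫ z in (0 : ℝ)..1, ψ z ^ 2) * M := by
  have hM0 : 0 ≤ M := (abs_nonneg _).trans (hM 0 ⟨le_rfl, ht⟩)
  have hI : 0 ≤ ∫ z in (0 : ℝ)..1, u 0 z ^ 2 :=
    intervalIntegral.integral_nonneg zero_le_one fun z _ => sq_nonneg _
  have hJ : 0 ≤ ∫ z in (0 : ℝ)..1, ψ z ^ 2 :=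
    intervalIntegral.integral_nonneg zero_le_one fun z _ => sq_nonneg _
  have hi : 0 < ε⁻¹ := inv_pos.2 hε
  refine (Real.sqrt_le_sqrt (hu.integral_sq_le hD hψ ht hM hε)).trans ?_
  refine Real.sqrt_le_iff.2 ⟨by positivity, ?_⟩
  have hexp : Real.exp (-(2 * (D * (ζ ^ 2 + freq a 0 ^ 2)) * t)) =
      Real.exp (-(D * (ζ ^ 2 + freq a 0 ^ 2) * t)) ^ 2 := by
    rw [← Real.exp_nat_mul]; congr 1; push_cast; ring
  have h1 := Real.sq_sqrt hI
  have h2 := Real.sq_sqrt hJ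
  have h3 := Real.sq_sqrt (by linarith : 0 ≤ 1 + ε)
  have h4 := Real.sq_sqrt (by linarith : 0 ≤ 1 + ε⁻¹)
  set x := Real.exp (-(D * (ζ ^ 2 + freq a 0 ^ 2) * t)) *
        (Real.sqrt (1 + ε) * Real.sqrt (∫ z in (0 : ℝ)..1, u 0 z ^ 2)) with hx
  set y := Real.sqrt (1 + ε⁻¹) * Real.sqrt (∫ z in (0 : ℝ)..1, ψ z ^ 2) * M with hy
  have hx0 : 0 ≤ x := by positivity
  have hy0 : 0 ≤ y := by positivity
  have ex : x ^ 2 = (1 + ε) * (Real.exp (-(2 * (D * (ζ ^ 2 + freq a 0 ^ 2)) * t)) *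
        ∫ z in (0 : ℝ)..1, u 0 z ^ 2) := by
    rw [hx, mul_pow, mul_pow, h1, h3, hexp]; ring
  have ey : y ^ 2 = (1 + ε⁻¹) * (M ^ 2 * ∫ z in (0 : ℝ)..1, ψ z ^ 2) := by
    rw [hy, mul_pow, mul_pow, h2, h4]; ring
  rw [← ex, ← ey]
  nlinarith [mul_nonneg hx0 hy0]

/-- A solution with zero inlet value and zero initial value vanishes. -/
theorem HeatSol.eq_zero {D ζ : ℝ} {a : ℝ≥0∞} {u r : ℝ → ℝ → ℝ}
    (hD : 0 < D) (hu : HeatSol D ζ a (fun _ => 0) u r)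
    (h0 : ∀ z ∈ Icc (0 : ℝ) 1, u 0 z = 0) {t : ℝ} (ht : 0 ≤ t) {z : ℝ} (hz : z ∈ Icc (0 : ℝ) 1) :
    u t z = 0 := by
  -- With zero initial energy the positive part vanishes. Applied to `u` and to `-u`.
  have hle : ∀ {v s : ℝ → ℝ → ℝ}, HeatSol D ζ a (fun _ => 0) v s →
      (∀ z ∈ Icc (0 : ℝ) 1, v 0 z = 0) → v t z ≤ 0 := by
    intro v s hv hv0
    have h := hv.energy_le hD ht (fun _ _ => le_rfl)
    have e : ∫ z in (0 : ℝ)..1, max (v 0 z) 0 ^ 2 = 0 := by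
      rw [integral_congr (g := fun _ => (0 : ℝ)) fun z hz => ?_]
      · simp
      · rw [uIcc_of_le zero_le_one] at hz
        simp [hv0 z hz]
    rw [e, mul_zero] at h
    by_contra hcon
    push Not at hcon
    have hpos : 0 < ∫ z in (0 : ℝ)..1, max (v t z) 0 ^ 2 := by
      refine intervalIntegral.integral_pos zero_lt_one
        (((hv.continuousOn_slice ht).sup continuousOn_const).pow 2)
        (fun z _ => sq_nonneg _) ⟨z, hz, ?_⟩
      have := lt_max_of_lt_left (b := v t z) (c := (0 : ℝ)) hcon
      positivity
    linarith
  have h1 := hle hu h0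
  have hneg : HeatSol D ζ a (fun _ => 0) (fun t z => 0 - u t z) (fun t z => 0 - r t z) := by
    simpa using (HeatSol.zero (D := D) (ζ := ζ) (a := a)).sub hu
  have h2 := hle hneg (fun z hz => by simp [h0 z hz])
  linarith

/-! ### The explicit steady state, its norm and the secondary lift -/

/-- Coefficient of `exp (ζ z)` in the steady state with inlet value `1`. -/
noncomputable def steadyCoeff₁ (ζ : ℝ) (a : ℝ≥0∞) : ℝ :=
  if a = ⊤ then -1 / (Real.exp (2 * ζ) - 1) else c₁ ζ a.toReal

/-- Coefficient of `exp (-ζ z)` in the steady state with inlet value `1`. -/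
noncomputable def steadyCoeff₂ (ζ : ℝ) (a : ℝ≥0∞) : ℝ :=
  if a = ⊤ then Real.exp (2 * ζ) / (Real.exp (2 * ζ) - 1) else c₂ ζ a.toReal

theorem one_lt_exp_two_mul {ζ : ℝ} (hζ : 0 < ζ) : 1 < Real.exp (2 * ζ) :=
  Real.one_lt_exp_iff.2 (by linarith)

theorem steady_denom_pos {ζ a : ℝ} (hζ : 0 < ζ) (ha : 0 ≤ a) :
    0 < (ζ + a) * Real.exp (2 * ζ) + ζ - a := by
  have := one_lt_exp_two_mul hζ
  nlinarith

/-- The steady state with inlet value `1`. -/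
noncomputable def steadyState (ζ : ℝ) (a : ℝ≥0∞) (z : ℝ) : ℝ :=
  steadyCoeff₁ ζ a * Real.exp (ζ * z) + steadyCoeff₂ ζ a * Real.exp (-ζ * z)

/-- The derivative of `steadyState`. -/
noncomputable def steadyState' (ζ : ℝ) (a : ℝ≥0∞) (z : ℝ) : ℝ :=
  steadyCoeff₁ ζ a * (ζ * Real.exp (ζ * z)) + steadyCoeff₂ ζ a * (-ζ * Real.exp (-ζ * z))

theorem isSteady_steadyState {ζ : ℝ} (hζ : 0 < ζ) (a : ℝ≥0∞) :
    IsSteady ζ a (steadyState ζ a) (steadyState' ζ a) (fun z => ζ ^ 2 * steadyState ζ a z) where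
  isC2 := by
    have h := ((isC2_exp ζ).const_mul (steadyCoeff₁ ζ a)).add
      ((isC2_exp (-ζ)).const_mul (steadyCoeff₂ ζ a))
    have e : (fun z => ζ ^ 2 * steadyState ζ a z) = fun z =>
        steadyCoeff₁ ζ a * (ζ ^ 2 * Real.exp (ζ * z)) +
          steadyCoeff₂ ζ a * ((-ζ) ^ 2 * Real.exp (-ζ * z)) := by
      funext z; unfold steadyState; ring
    rw [e]
    exact h
  eq z := rfl
  inlet := by
    have h1 := one_lt_exp_two_mul hζ
    have h2 := steady_denom_pos hζ (ENNReal.toReal_nonneg (a := a))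
    simp only [steadyState, mul_zero, Real.exp_zero, mul_one]
    by_cases ha : a = ⊤
    · simp only [steadyCoeff₁, steadyCoeff₂, ha, if_true]
      have : Real.exp (2 * ζ) - 1 ≠ 0 := by linarith
      field_simp; ring
    · simp only [steadyCoeff₁, steadyCoeff₂, ha, if_false, c₁, c₂]
      rw [← add_div, div_eq_one_iff_eq h2.ne']; ring
  exit := by
    have h1 := one_lt_exp_two_mul hζ
    have h2 := steady_denom_pos hζ (ENNReal.toReal_nonneg (a := a))
    have e1 : Real.exp (2 * ζ) = Real.exp ζ ^ 2 := by rw [← Real.exp_nat_mul]; norm_num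
    have hx := Real.exp_pos ζ
    constructor
    · intro ha
      simp only [steadyState, steadyCoeff₁, steadyCoeff₂, ha, if_true, mul_one, Real.exp_neg]
      rw [e1] at h1 ⊢
      have : Real.exp ζ ^ 2 - 1 ≠ 0 := by linarith
      field_simp; ring
    · intro ha
      simp only [steadyState, steadyState', steadyCoeff₁, steadyCoeff₂, ha, if_false, mul_one,
        Real.exp_neg, c₁, c₂]
      rw [e1] at h2 ⊢
      field_simp
      ring
  nonneg z hz := by
    have h1 := one_lt_exp_two_mul hζ
    have h2 := steady_denom_pos hζ (ENNReal.toReal_nonneg (a := a))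
    have ha0 := ENNReal.toReal_nonneg (a := a)
    -- This is where `z ≤ 1` enters. It lets the decaying exponential dominate when `a > ζ`, where
    -- the coefficient of the growing one is negative.
    have h3 : Real.exp (ζ * z) ≤ Real.exp (2 * ζ) * Real.exp (-ζ * z) := by
      rw [← Real.exp_add, Real.exp_le_exp]
      nlinarith [hz.1, hz.2]
    have hx := Real.exp_pos (ζ * z)
    by_cases ha : a = ⊤
    · simp only [steadyState, steadyCoeff₁, steadyCoeff₂, ha, if_true]
      have e : -1 / (Real.exp (2 * ζ) - 1) * Real.exp (ζ * z) +
          Real.exp (2 * ζ) / (Real.exp (2 * ζ) - 1) * Real.exp (-ζ * z) =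
          (Real.exp (2 * ζ) * Real.exp (-ζ * z) - Real.exp (ζ * z)) /
            (Real.exp (2 * ζ) - 1) := by ring
      rw [e]
      exact div_nonneg (by linarith) (by linarith)
    · simp only [steadyState, steadyCoeff₁, steadyCoeff₂, ha, if_false, c₁, c₂]
      have e : ∀ den : ℝ, (ζ - a.toReal) / den * Real.exp (ζ * z) +
          ((ζ + a.toReal) * Real.exp (2 * ζ)) / den * Real.exp (-ζ * z) =
          ((ζ + a.toReal) * (Real.exp (2 * ζ) * Real.exp (-ζ * z)) +
            (ζ - a.toReal) * Real.exp (ζ * z)) / den := by intro den; ring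
      rw [e]
      refine div_nonneg ?_ h2.le
      nlinarith

theorem integral_exp_mul {c : ℝ} (hc : c ≠ 0) :
    ∫ z in (0 : ℝ)..1, Real.exp (c * z) = (Real.exp c - 1) / c := by
  rw [intervalIntegral.integral_comp_mul_left (fun x => Real.exp x) hc, integral_exp]
  simp; field_simp

theorem integral_steadyState_sq {ζ : ℝ} (hζ : 0 < ζ) (a : ℝ≥0∞) :
    ∫ z in (0 : ℝ)..1, steadyState ζ a z ^ 2 =
      steadyCoeff₁ ζ a ^ 2 * ((Real.exp (2 * ζ) - 1) / (2 * ζ)) +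
      steadyCoeff₂ ζ a ^ 2 * ((1 - Real.exp (-2 * ζ)) / (2 * ζ)) +
      2 * steadyCoeff₁ ζ a * steadyCoeff₂ ζ a := by
  have e : ∀ z, steadyState ζ a z ^ 2 = steadyCoeff₁ ζ a ^ 2 * Real.exp (2 * ζ * z) +
      steadyCoeff₂ ζ a ^ 2 * Real.exp (-2 * ζ * z) + 2 * steadyCoeff₁ ζ a * steadyCoeff₂ ζ a := by
    intro z
    have h1 : Real.exp (2 * ζ * z) = Real.exp (ζ * z) ^ 2 := by
      rw [← Real.exp_nat_mul]; congr 1; push_cast; ring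
    have h2 : Real.exp (-2 * ζ * z) = Real.exp (-ζ * z) ^ 2 := by
      rw [← Real.exp_nat_mul]; congr 1; push_cast; ring
    have h3 : Real.exp (ζ * z) * Real.exp (-ζ * z) = 1 := by
      rw [← Real.exp_add]; simp
    rw [h1, h2, steadyState]
    linear_combination 2 * steadyCoeff₁ ζ a * steadyCoeff₂ ζ a * h3
  simp only [e]
  rw [integral_add (Continuous.intervalIntegrable (by fun_prop) _ _)
    (Continuous.intervalIntegrable (by fun_prop) _ _),
    integral_add (Continuous.intervalIntegrable (by fun_prop) _ _)
    (Continuous.intervalIntegrable (by fun_prop) _ _),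
    intervalIntegral.integral_const_mul, intervalIntegral.integral_const_mul,
    integral_exp_mul (by positivity), integral_exp_mul (by linarith)]
  have : (Real.exp (-2 * ζ) - 1) / (-2 * ζ) = (1 - Real.exp (-2 * ζ)) / (2 * ζ) := by
    rw [← neg_div_neg_eq]; congr 1 <;> ring
  rw [this]
  simp

theorem sqrt_integral_steadyState_sq {ζ : ℝ} (hζ : 0 < ζ) (a : ℝ≥0∞) :
    Real.sqrt (∫ z in (0 : ℝ)..1, steadyState ζ a z ^ 2) = gainClosedForm ζ a := by
  rw [integral_steadyState_sq hζ]
  by_cases ha : a = ⊤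
  · simp only [steadyCoeff₁, steadyCoeff₂, gainClosedForm, ha, if_true]
    have h1 := one_lt_exp_two_mul hζ
    have e4 : Real.exp (4 * ζ) = Real.exp (2 * ζ) ^ 2 := by
      rw [← Real.exp_nat_mul]; congr 1; push_cast; ring
    have e2 : Real.exp (-2 * ζ) = (Real.exp (2 * ζ))⁻¹ := by
      rw [← Real.exp_neg]; congr 1; ring
    have h3 : 0 ≤ 1 / (Real.exp (2 * ζ) - 1) := div_nonneg zero_le_one (by linarith)
    rw [← Real.sqrt_sq h3, ← Real.sqrt_mul (sq_nonneg _)]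
    congr 1
    rw [e4, e2]
    have : Real.exp (2 * ζ) - 1 ≠ 0 := by linarith
    have := Real.exp_pos (2 * ζ)
    field_simp
    ring
  · simp only [steadyCoeff₁, steadyCoeff₂, gainClosedForm, ha, if_false]

/-- The solution `χ` of `χ'' - ζ² χ = ψ`, `χ(0) = 0`, with the exit condition. -/
theorem exists_secondary {ζ : ℝ} (hζ : 0 < ζ) (a : ℝ≥0∞) :
    ∃ χ χ' χ'' : ℝ → ℝ, IsC2 χ χ' χ'' ∧ (∀ z, χ'' z = ζ ^ 2 * χ z + steadyState ζ a z) ∧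
      χ 0 = 0 ∧ ExitBC a (χ 1) (χ' 1) := by
  -- The source `ψ` solves the homogeneous equation (resonance), so the particular solution carries
  -- a factor `z`: it is `z (c₁ exp (ζ z) - c₂ exp (-ζ z)) / (2 ζ)`. It vanishes at `0`, and so does
  -- the homogeneous solution `hhom`, which is added to meet the exit condition.
  have hp : IsC2 (fun z => z) (fun _ => 1) (fun _ => 0) :=
    ⟨fun x => hasDerivAt_id x, fun x => hasDerivAt_const x _, continuous_const⟩
  have hpart := (hp.mul (((isC2_exp ζ).const_mul (steadyCoeff₁ ζ a)).sub
      ((isC2_exp (-ζ)).const_mul (steadyCoeff₂ ζ a)))).const_mul (1 / (2 * ζ))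
  have hhom := (isC2_exp ζ).sub (isC2_exp (-ζ))
  have hx : 0 < Real.exp ζ - Real.exp (-ζ) := by
    rw [sub_pos, Real.exp_lt_exp]; linarith
  have hx' : 0 < ζ * Real.exp ζ + ζ * Real.exp (-ζ) := by positivity
  have ha0 := ENNReal.toReal_nonneg (a := a)
  have main : ∀ C : ℝ, _ := fun C => hpart.add (hhom.const_mul C)
  -- The exit condition is linear in `C`, with a coefficient that is positive because `ζ > 0` and `a
  -- ≥ 0`.
  obtain ⟨C, hC⟩ : ∃ C : ℝ, ExitBC a
      (1 / (2 * ζ) * (1 * (steadyCoeff₁ ζ a * Real.exp (ζ * 1) -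
        steadyCoeff₂ ζ a * Real.exp (-ζ * 1))) + C * (Real.exp (ζ * 1) - Real.exp (-ζ * 1)))
      (1 / (2 * ζ) * (1 * (steadyCoeff₁ ζ a * Real.exp (ζ * 1) -
        steadyCoeff₂ ζ a * Real.exp (-ζ * 1)) + 1 * (steadyCoeff₁ ζ a * (ζ * Real.exp (ζ * 1)) -
        steadyCoeff₂ ζ a * (-ζ * Real.exp (-ζ * 1)))) +
        C * (ζ * Real.exp (ζ * 1) - -ζ * Real.exp (-ζ * 1))) := by
    simp only [mul_one]
    generalize 1 / (2 * ζ) * (1 * (steadyCoeff₁ ζ a * Real.exp ζ -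
        steadyCoeff₂ ζ a * Real.exp (-ζ))) = X
    generalize 1 / (2 * ζ) * (1 * (steadyCoeff₁ ζ a * Real.exp ζ -
        steadyCoeff₂ ζ a * Real.exp (-ζ)) + 1 * (steadyCoeff₁ ζ a * (ζ * Real.exp ζ) -
        steadyCoeff₂ ζ a * (-ζ * Real.exp (-ζ)))) = Y
    by_cases ha : a = ⊤
    · refine ⟨-X / (Real.exp ζ - Real.exp (-ζ)), fun _ => ?_, fun h => absurd ha h⟩
      field_simp; ring
    · have hden : 0 < ζ * Real.exp ζ + ζ * Real.exp (-ζ) +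
          a.toReal * (Real.exp ζ - Real.exp (-ζ)) := by positivity
      refine ⟨-(Y + a.toReal * X) / (ζ * Real.exp ζ + ζ * Real.exp (-ζ) +
          a.toReal * (Real.exp ζ - Real.exp (-ζ))), fun h => absurd h ha, fun _ => ?_⟩
      linear_combination div_mul_cancel₀ (-(Y + a.toReal * X)) hden.ne'
  refine ⟨_, _, _, main C, fun z => ?_, by simp, hC⟩
  simp only [steadyState]
  field_simp
  ring

/-! ### Abstract min-max principle and spectral projection -/

section Abstract

variable {V : Type*} [AddCommGroup V] [Module ℝ V] {N : ℕ} {B Q : V →ₗ[ℝ] V →ₗ[ℝ] ℝ}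
  {φ : Fin N → V} {l : Fin N → ℝ}

theorem form_apply_linearCombination (F : V →ₗ[ℝ] V →ₗ[ℝ] ℝ) (x : V) (c : Fin N → ℝ) :
    F x (Fintype.linearCombination ℝ φ c) = ∑ j, c j * F x (φ j) := by
  simp [Fintype.linearCombination_apply]

theorem form_linearCombination_apply (horth : ∀ i j, i ≠ j → B (φ i) (φ j) = 0)
    (c : Fin N → ℝ) (j : Fin N) :
    B (Fintype.linearCombination ℝ φ c) (φ j) = c j * B (φ j) (φ j) := by
  rw [Fintype.linearCombination_apply, map_sum, LinearMap.sum_apply,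
    Finset.sum_eq_single j (fun i _ hi => by simp [horth i j hi]) (by simp)]
  simp

theorem form_linearCombination_self (horth : ∀ i j, i ≠ j → B (φ i) (φ j) = 0)
    (c : Fin N → ℝ) :
    B (Fintype.linearCombination ℝ φ c) (Fintype.linearCombination ℝ φ c) =
      ∑ j, c j ^ 2 * B (φ j) (φ j) := by
  rw [form_apply_linearCombination]
  refine Finset.sum_congr rfl fun j _ => ?_
  rw [form_linearCombination_apply horth]; ring

theorem energy_linearCombination_self (hQ : ∀ x j, Q x (φ j) = l j * B x (φ j))
    (horth : ∀ i j, i ≠ j → B (φ i) (φ j) = 0) (c : Fin N → ℝ) :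
    Q (Fintype.linearCombination ℝ φ c) (Fintype.linearCombination ℝ φ c) =
      ∑ j, l j * (c j ^ 2 * B (φ j) (φ j)) := by
  rw [form_apply_linearCombination]
  refine Finset.sum_congr rfl fun j _ => ?_
  rw [hQ, form_linearCombination_apply horth]; ring

/-- A min-max principle: if `K B ≤ Q` holds under `N` linear constraints, with `K` above the first
`N` eigenvalues, then it holds on the orthogonal complement of the first `N` eigenvectors. -/
theorem form_le_energy_of_orthogonal (hBs : ∀ x y, B x y = B y x) (hQs : ∀ x y, Q x y = Q y x)
    (hQ : ∀ x j, Q x (φ j) = l j * B x (φ j))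
    (horth : ∀ i j, i ≠ j → B (φ i) (φ j) = 0) (hpos : ∀ j, 0 < B (φ j) (φ j))
    (ev : V →ₗ[ℝ] (Fin N → ℝ)) {K : ℝ} (hK : ∀ j, l j < K)
    (hev : ∀ x, ev x = 0 → K * B x x ≤ Q x x) {x : V} (hx : ∀ j, B x (φ j) = 0) :
    K * B x x ≤ Q x x := by
  set S := Fintype.linearCombination ℝ φ with hS
  have hdiff : ∀ c, K * B (S c) (S c) - Q (S c) (S c) =
      ∑ j, (K - l j) * (c j ^ 2 * B (φ j) (φ j)) := by
    intro c
    rw [hS, form_linearCombination_self horth, energy_linearCombination_self hQ horth,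
      Finset.mul_sum, ← Finset.sum_sub_distrib]
    exact Finset.sum_congr rfl fun j _ => by ring
  have hterm : ∀ (c : Fin N → ℝ) j, 0 ≤ (K - l j) * (c j ^ 2 * B (φ j) (φ j)) := fun c j =>
    mul_nonneg (sub_nonneg.2 (hK j).le) (mul_nonneg (sq_nonneg _) (hpos j).le)
  -- A combination killed by the constraints has `K B ≤ Q`, while on the span `K B - Q` is a sum of
  -- nonnegative terms with positive weights `K - l j`; all coefficients must vanish.
  have hinj : Function.Injective (ev ∘ₗ S) := by
    rw [← LinearMap.ker_eq_bot, LinearMap.ker_eq_bot']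
    intro c hc
    have h1 := hev (S c) hc
    have h2 : ∑ j, (K - l j) * (c j ^ 2 * B (φ j) (φ j)) = 0 :=
      le_antisymm (by rw [← hdiff]; linarith) (Finset.sum_nonneg fun j _ => hterm c j)
    funext j
    have h3 := (Finset.sum_eq_zero_iff_of_nonneg fun j _ => hterm c j).1 h2 j (Finset.mem_univ j)
    simpa [sub_ne_zero.2 (hK j).ne', (hpos j).ne'] using h3
  -- Dimensions agree, so some combination `S c` corrects `x` to satisfy the constraints. The cross
  -- terms of `x` and `S c` vanish, and `K B ≥ Q` on `S c`, so the inequality for `x + S c` passes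
  -- to `x`.
  obtain ⟨c, hc⟩ := LinearMap.injective_iff_surjective.1 hinj (-ev x)
  have h0 : ev (x + S c) = 0 := by
    rw [map_add]
    have : ev (S c) = -ev x := hc
    rw [this, add_neg_cancel]
  have h1 := hev _ h0
  have hBx : B x (S c) = 0 := by
    rw [hS, form_apply_linearCombination]
    exact Finset.sum_eq_zero fun j _ => by rw [hx j, mul_zero]
  have hQx : Q x (S c) = 0 := by
    rw [hS, form_apply_linearCombination]
    exact Finset.sum_eq_zero fun j _ => by rw [hQ, hx j, mul_zero, mul_zero]
  have hd := hdiff c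
  have hs : 0 ≤ ∑ j, (K - l j) * (c j ^ 2 * B (φ j) (φ j)) :=
    Finset.sum_nonneg fun j _ => hterm c j
  simp only [map_add, LinearMap.add_apply] at h1
  rw [hBs (S c) x, hQs (S c) x, hBx, hQx] at h1
  nlinarith

/-- Subtracting the spectral projection does not increase the energy. -/
theorem energy_sub_projection_le (hQs : ∀ x y, Q x y = Q y x)
    (hQ : ∀ x j, Q x (φ j) = l j * B x (φ j))
    (horth : ∀ i j, i ≠ j → B (φ i) (φ j) = 0) (hpos : ∀ j, 0 < B (φ j) (φ j))
    (hl : ∀ j, 0 ≤ l j) (x : V) {c : Fin N → ℝ} (hc : ∀ j, c j = B x (φ j) / B (φ j) (φ j)) :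
    (∀ j, B (x - Fintype.linearCombination ℝ φ c) (φ j) = 0) ∧
    Q (x - Fintype.linearCombination ℝ φ c) (x - Fintype.linearCombination ℝ φ c) ≤ Q x x := by
  have hB : ∀ j, B x (φ j) = c j * B (φ j) (φ j) := fun j => by
    rw [hc j, div_mul_cancel₀ _ (hpos j).ne']
  constructor
  · intro j
    rw [map_sub, LinearMap.sub_apply, form_linearCombination_apply horth, hB, sub_self]
  · have h1 : Q x (Fintype.linearCombination ℝ φ c) = ∑ j, l j * (c j ^ 2 * B (φ j) (φ j)) := by
      rw [form_apply_linearCombination]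
      refine Finset.sum_congr rfl fun j _ => ?_
      rw [hQ, hB]; ring
    have h2 := energy_linearCombination_self hQ horth c
    have h3 : 0 ≤ ∑ j, l j * (c j ^ 2 * B (φ j) (φ j)) := Finset.sum_nonneg fun j _ =>
      mul_nonneg (hl j) (mul_nonneg (sq_nonneg _) (hpos j).le)
    simp only [map_sub, LinearMap.sub_apply]
    rw [hQs (Fintype.linearCombination ℝ φ c) x, h1, h2]
    linarith

end Abstract

/-! ### Wirtinger's inequality -/

/-- Wirtinger's inequality on an interval of length `h < π / κ`. -/
theorem wirtinger {g g' : ℝ → ℝ} (hg : ∀ x, HasDerivAt g (g' x) x) (hg' : Continuous g')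
    {x y κ : ℝ} (hxy : x ≤ y) (hκ : 0 < κ) (hlt : κ * (y - x) < Real.pi)
    (hx : g x = 0) (hy : g y = 0) :
    ∫ z in x..y, κ ^ 2 * g z ^ 2 ≤ ∫ z in x..y, g' z ^ 2 := by
  have hgc : Continuous g := continuous_iff_continuousAt.2 fun x => (hg x).continuousAt
  -- The phase centres the arch of the sine on `[x, y]`. Its logarithmic derivative `ρ` solves `ρ' =
  -- -κ² - ρ²`, so `g'² - κ² g² = (g' - ρ g)² + (g² ρ)'`, and the last term integrates to zero.
  set θ : ℝ := (Real.pi - κ * (y - x)) / 2 - κ * x with hθ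
  set ρ : ℝ → ℝ := fun z => κ * Real.cos (θ + κ * z) / Real.sin (θ + κ * z) with hρ
  have hu : uIcc x y = Icc x y := uIcc_of_le hxy
  have hsin : ∀ z ∈ Icc x y, 0 < Real.sin (θ + κ * z) := by
    intro z hz
    have h1 := mul_le_mul_of_nonneg_left hz.1 hκ.le
    have h2 := mul_le_mul_of_nonneg_left hz.2 hκ.le
    refine Real.sin_pos_of_mem_Ioo ⟨?_, ?_⟩ <;> rw [hθ] <;> linarith
  have hρc : ContinuousOn ρ (Icc x y) :=
    ContinuousOn.div (by fun_prop) (by fun_prop) fun z hz => (hsin z hz).ne'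
  have hρd : ∀ z ∈ Icc x y, HasDerivAt ρ (-κ ^ 2 - ρ z ^ 2) z := by
    intro z hz
    have hs := isC2_sin θ κ
    refine ((hs.hasDerivAt' z).div (hs.hasDerivAt z) (hsin z hz).ne').congr_deriv ?_
    have := (hsin z hz).ne'
    simp only [hρ]
    field_simp
  have hint : IntervalIntegrable (fun z => 2 * g z * g' z * ρ z + g z ^ 2 * (-κ ^ 2 - ρ z ^ 2))
      volume x y := ContinuousOn.intervalIntegrable (by
    rw [hu]
    exact ((by fun_prop : Continuous fun z => 2 * g z * g' z).continuousOn.mul hρc).add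
      ((by fun_prop : Continuous fun z => g z ^ 2).continuousOn.mul
        (continuousOn_const.sub (hρc.pow 2))))
  have h0 : ∫ z in x..y, (2 * g z * g' z * ρ z + g z ^ 2 * (-κ ^ 2 - ρ z ^ 2)) = 0 := by
    rw [integral_eq_sub_of_hasDerivAt (f := fun z => g z ^ 2 * ρ z) (fun z hz => ?_) hint]
    · simp [hx, hy]
    · exact (((hg z).pow 2).mul (hρd z (hu ▸ hz))).congr_deriv (by simp)
  have i1 : IntervalIntegrable (fun z => g' z ^ 2) volume x y :=
    Continuous.intervalIntegrable (by fun_prop) _ _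
  have i2 : IntervalIntegrable (fun z => κ ^ 2 * g z ^ 2) volume x y :=
    Continuous.intervalIntegrable (by fun_prop) _ _
  have h1 : ∫ z in x..y, (2 * g z * g' z * ρ z + g z ^ 2 * (-κ ^ 2 - ρ z ^ 2)) ≤
      ∫ z in x..y, (g' z ^ 2 - κ ^ 2 * g z ^ 2) :=
    integral_mono_on hxy hint (i1.sub i2) fun z _ => by nlinarith [sq_nonneg (g' z - g z * ρ z)]
  rw [h0, integral_sub i1 i2] at h1
  linarith

/-- Wirtinger's inequality for a function that vanishes at the points `k / L`, `0 ≤ k ≤ L`. -/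
theorem wirtinger_grid {g g' : ℝ → ℝ} (hg : ∀ x, HasDerivAt g (g' x) x) (hg' : Continuous g')
    {L : ℕ} (hL : 0 < L) {κ : ℝ} (hκ : 0 < κ) (hlt : κ < Real.pi * L)
    (h0 : ∀ k ≤ L, g (k / L) = 0) :
    κ ^ 2 * ∫ z in (0 : ℝ)..1, g z ^ 2 ≤ ∫ z in (0 : ℝ)..1, g' z ^ 2 := by
  have hgc : Continuous g := continuous_iff_continuousAt.2 fun x => (hg x).continuousAt
  have hL' : (0 : ℝ) < L := by exact_mod_cast hL
  rw [← intervalIntegral.integral_const_mul]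
  have hsum : ∀ F : ℝ → ℝ, Continuous F → ∫ z in (0 : ℝ)..1, F z =
      ∑ k ∈ Finset.range L, ∫ z in ((k : ℝ) / L)..(((k + 1 : ℕ) : ℝ) / L), F z := by
    intro F hF
    rw [sum_integral_adjacent_intervals (a := fun k : ℕ => (k : ℝ) / L)
      (fun k _ => hF.intervalIntegrable _ _)]
    simp [div_self hL'.ne']
  rw [hsum _ (by fun_prop), hsum _ (by fun_prop)]
  refine Finset.sum_le_sum fun k hk => ?_
  have hk' := Finset.mem_range.1 hk
  refine wirtinger hg hg' (by gcongr; simp) hκ ?_ (h0 k hk'.le) (h0 (k + 1) hk')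
  have : ((k + 1 : ℕ) : ℝ) / L - k / L = 1 / L := by push_cast; ring
  rw [this, mul_one_div, div_lt_iff₀ hL']
  exact hlt

/-! ### Quadratic forms, eigenfunctions and the spectral gap -/

/-- `C¹` functions with the essential boundary conditions. -/
def energySpace (a : ℝ≥0∞) : Submodule ℝ (ℝ → ℝ) where
  carrier := {f | ContDiff ℝ 1 f ∧ f 0 = 0 ∧ (a = ⊤ → f 1 = 0)}
  add_mem' := fun {f g} hf hg => ⟨hf.1.add hg.1, by simp [hf.2.1, hg.2.1],
    fun h => by simp [hf.2.2 h, hg.2.2 h]⟩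
  zero_mem' := ⟨contDiff_const, rfl, fun _ => rfl⟩
  smul_mem' := fun c f hf => ⟨contDiff_const.mul hf.1, by simp [hf.2.1],
    fun h => by simp [hf.2.2 h]⟩

namespace energySpace

variable {a : ℝ≥0∞}

theorem continuous (f : energySpace a) : Continuous (f : ℝ → ℝ) := f.2.1.continuous

theorem continuous_deriv (f : energySpace a) : Continuous (deriv (f : ℝ → ℝ)) :=
  f.2.1.continuous_deriv le_rfl

theorem hasDerivAt (f : energySpace a) (x : ℝ) : HasDerivAt (f : ℝ → ℝ) (deriv f x) x :=
  (f.2.1.differentiable (by norm_num) x).hasDerivAt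

theorem deriv_add (f g : energySpace a) :
    deriv ((f + g : energySpace a) : ℝ → ℝ) = fun x => deriv f x + deriv g x :=
  funext fun x => ((energySpace.hasDerivAt f x).add ((energySpace.hasDerivAt g) x)).deriv

theorem deriv_smul (c : ℝ) (f : energySpace a) :
    deriv ((c • f : energySpace a) : ℝ → ℝ) = fun x => c * deriv f x :=
  funext fun x => ((energySpace.hasDerivAt f x).const_mul c).deriv

end energySpace

/-- The `L²(0,1)` inner product on `energySpace a`. -/
noncomputable def massForm (a : ℝ≥0∞) : energySpace a →ₗ[ℝ] energySpace a →ₗ[ℝ] ℝ :=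
  LinearMap.mk₂ ℝ (fun f g => ∫ z in (0 : ℝ)..1, (f : ℝ → ℝ) z * (g : ℝ → ℝ) z)
    (fun f₁ f₂ g => by
      have := (energySpace.continuous f₁); have := (energySpace.continuous f₂); have := (energySpace.continuous g)
      rw [← integral_add (Continuous.intervalIntegrable (by fun_prop) _ _)
        (Continuous.intervalIntegrable (by fun_prop) _ _)]
      exact integral_congr fun z _ => by simp [add_mul])
    (fun c f g => by
      rw [smul_eq_mul, ← intervalIntegral.integral_const_mul]
      exact integral_congr fun z _ => by simp [mul_assoc])
    (fun f g₁ g₂ => by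
      have := (energySpace.continuous f); have := (energySpace.continuous g₁); have := (energySpace.continuous g₂)
      rw [← integral_add (Continuous.intervalIntegrable (by fun_prop) _ _)
        (Continuous.intervalIntegrable (by fun_prop) _ _)]
      exact integral_congr fun z _ => by simp [mul_add])
    (fun c f g => by
      rw [smul_eq_mul, ← intervalIntegral.integral_const_mul]
      exact integral_congr fun z _ => by simp [mul_left_comm])

/-- The Dirichlet form with the boundary term of the exit condition. -/
noncomputable def energyForm (a : ℝ≥0∞) : energySpace a →ₗ[ℝ] energySpace a →ₗ[ℝ] ℝ :=
  -- For `a = ⊤` the value `a.toReal` is `0`, so no boundary term appears; `f 1 = 0` holds anyway.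
  LinearMap.mk₂ ℝ (fun f g => (∫ z in (0 : ℝ)..1, deriv f z * deriv g z) +
      a.toReal * ((f : ℝ → ℝ) 1 * (g : ℝ → ℝ) 1))
    (fun f₁ f₂ g => by
      have := (energySpace.continuous_deriv f₁); have := (energySpace.continuous_deriv f₂); have := (energySpace.continuous_deriv g)
      simp only [energySpace.deriv_add, add_mul]
      rw [integral_add (Continuous.intervalIntegrable (by fun_prop) _ _)
        (Continuous.intervalIntegrable (by fun_prop) _ _)]
      simp only [Submodule.coe_add, Pi.add_apply]
      ring)
    (fun c f g => by
      simp only [energySpace.deriv_smul, mul_assoc]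
      rw [intervalIntegral.integral_const_mul]
      simp only [Submodule.coe_smul, Pi.smul_apply, smul_eq_mul]
      ring)
    (fun f g₁ g₂ => by
      have := (energySpace.continuous_deriv f); have := (energySpace.continuous_deriv g₁); have := (energySpace.continuous_deriv g₂)
      simp only [energySpace.deriv_add, mul_add]
      rw [integral_add (Continuous.intervalIntegrable (by fun_prop) _ _)
        (Continuous.intervalIntegrable (by fun_prop) _ _)]
      simp only [Submodule.coe_add, Pi.add_apply]
      ring)
    (fun c f g => by
      simp only [energySpace.deriv_smul, mul_left_comm _ c]
      rw [intervalIntegral.integral_const_mul]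
      simp only [Submodule.coe_smul, Pi.smul_apply, smul_eq_mul]
      ring)

theorem massForm_apply {a : ℝ≥0∞} (f g : energySpace a) :
    massForm a f g = ∫ z in (0 : ℝ)..1, (f : ℝ → ℝ) z * (g : ℝ → ℝ) z := rfl

theorem energyForm_apply {a : ℝ≥0∞} (f g : energySpace a) :
    energyForm a f g = (∫ z in (0 : ℝ)..1, deriv f z * deriv g z) +
      a.toReal * ((f : ℝ → ℝ) 1 * (g : ℝ → ℝ) 1) := rfl

theorem massForm_comm {a : ℝ≥0∞} (f g : energySpace a) : massForm a f g = massForm a g f :=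
  integral_congr fun _ _ => mul_comm _ _

theorem energyForm_comm {a : ℝ≥0∞} (f g : energySpace a) :
    energyForm a f g = energyForm a g f := by
  rw [energyForm_apply, energyForm_apply, mul_comm ((f : ℝ → ℝ) 1)]
  congr 1
  exact integral_congr fun _ _ => mul_comm _ _

theorem isC2_sin_mul (c : ℝ) : IsC2 (fun z => Real.sin (c * z))
    (fun z => c * Real.cos (c * z)) (fun z => -c ^ 2 * Real.sin (c * z)) := by
  simpa using isC2_sin 0 c

/-- The `n`-th eigenfunction. -/
noncomputable def eigenfun (a : ℝ≥0∞) (n : ℕ) : energySpace a :=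
  ⟨fun z => Real.sin (freq a n * z), (isC2_sin_mul _).contDiff_two.of_le (by norm_num), by simp,
    fun h => by simpa using (exitBC_freq a n).1 h⟩

theorem eigenfun_apply (a : ℝ≥0∞) (n : ℕ) (z : ℝ) :
    (eigenfun a n : ℝ → ℝ) z = Real.sin (freq a n * z) := rfl

/-- One integration by parts. The boundary term at `1` cancels the Robin term, or vanishes by the
essential condition; the one at `0` vanishes since `f 0 = 0`. -/
theorem energyForm_eigenfun {a : ℝ≥0∞} (f : energySpace a) (n : ℕ) :
    energyForm a f (eigenfun a n) = freq a n ^ 2 * massForm a f (eigenfun a n) := by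
  have hs := isC2_sin_mul (freq a n)
  have hd : deriv (eigenfun a n : ℝ → ℝ) = fun z => freq a n * Real.cos (freq a n * z) :=
    funext fun z => (hs.hasDerivAt z).deriv
  have hparts := integral_deriv_mul_eq_sub (a := 0) (b := 1) (fun z _ => (energySpace.hasDerivAt f) z)
    (fun z _ => hs.hasDerivAt' z) ((energySpace.continuous_deriv f).intervalIntegrable _ _)
    (hs.continuous''.intervalIntegrable _ _)
  have hfc := (energySpace.continuous f)
  have hfc' := (energySpace.continuous_deriv f)
  rw [integral_add (Continuous.intervalIntegrable (by fun_prop) _ _)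
    (Continuous.intervalIntegrable (by fun_prop) _ _), f.2.2.1] at hparts
  have e : ∫ z in (0 : ℝ)..1, (f : ℝ → ℝ) z * (-freq a n ^ 2 * Real.sin (freq a n * z)) =
      -freq a n ^ 2 * massForm a f (eigenfun a n) := by
    rw [massForm_apply, ← intervalIntegral.integral_const_mul]
    exact integral_congr fun z _ => by simp only [eigenfun_apply]; ring
  rw [e] at hparts
  rw [energyForm_apply, hd, eigenfun_apply]
  have hbd : (f : ℝ → ℝ) 1 * (freq a n * Real.cos (freq a n * 1)) +
      a.toReal * ((f : ℝ → ℝ) 1 * Real.sin (freq a n * 1)) = 0 := by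
    by_cases h : a = ⊤
    · rw [f.2.2.2 h]; ring
    · rw [mul_one, (exitBC_freq a n).2 h]; ring
  linarith

theorem massForm_eigenfun_of_ne {a : ℝ≥0∞} {m n : ℕ} (h : m ≠ n) :
    massForm a (eigenfun a m) (eigenfun a n) = 0 := by
  have h1 := energyForm_eigenfun (eigenfun a m) n
  have h2 := energyForm_eigenfun (eigenfun a n) m
  rw [energyForm_comm, massForm_comm (eigenfun a n)] at h2
  have h3 : (freq a m ^ 2 - freq a n ^ 2) * massForm a (eigenfun a m) (eigenfun a n) = 0 := by
    linarith
  refine (mul_eq_zero.1 h3).resolve_left fun h4 => h ((freq_strictMono a).injective ?_)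
  exact (pow_left_inj₀ (freq_pos a m).le (freq_pos a n).le two_ne_zero).1 (by linarith)

/-- The squared `L²` norm of the `n`-th eigenfunction. -/
noncomputable def eigenNormSq (a : ℝ≥0∞) (n : ℕ) : ℝ :=
  1 / 2 + Real.sin (2 * mu (n + 1) a * Real.pi) / (4 * freq a n)

theorem massForm_eigenfun_self (a : ℝ≥0∞) (n : ℕ) :
    massForm a (eigenfun a n) (eigenfun a n) = eigenNormSq a n := by
  have hω := freq_pos a n
  have hd : ∀ z, HasDerivAt (fun z => z / 2 - Real.sin (2 * freq a n * z) / (4 * freq a n))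
      (Real.sin (freq a n * z) * Real.sin (freq a n * z)) z := fun z => by
    refine (((hasDerivAt_id z).div_const 2).sub
      (((isC2_sin_mul (2 * freq a n)).hasDerivAt z).div_const (4 * freq a n))).congr_deriv ?_
    have e : 2 * freq a n * z = 2 * (freq a n * z) := by ring
    rw [e, Real.cos_two_mul, Real.cos_sq']
    field_simp
    ring
  have h := integral_eq_sub_of_hasDerivAt (a := 0) (b := 1) (fun z _ => hd z)
    (Continuous.intervalIntegrable (by fun_prop) _ _)
  simp only [massForm_apply, eigenfun_apply]
  rw [h, eigenNormSq]
  have e : Real.sin (2 * freq a n * 1) = -Real.sin (2 * mu (n + 1) a * Real.pi) := by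
    have : 2 * freq a n * 1 = ((n + 1 : ℕ) : ℝ) * (2 * Real.pi) - 2 * mu (n + 1) a * Real.pi := by
      unfold freq; ring
    rw [this, Real.sin_nat_mul_two_pi_sub]
  rw [e]
  simp
  ring

theorem half_le_eigenNormSq (a : ℝ≥0∞) (n : ℕ) : 1 / 2 ≤ eigenNormSq a n := by
  have h1 := mu_nonneg a (Nat.le_add_left 1 n)
  have h2 := mu_le_half a (Nat.le_add_left 1 n)
  have hpi := Real.pi_pos
  have : 0 ≤ Real.sin (2 * mu (n + 1) a * Real.pi) :=
    Real.sin_nonneg_of_nonneg_of_le_pi (by positivity) (by nlinarith)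
  have hω := freq_pos a n
  have : 0 ≤ Real.sin (2 * mu (n + 1) a * Real.pi) / (4 * freq a n) := by positivity
  unfold eigenNormSq
  linarith

theorem eigenNormSq_pos (a : ℝ≥0∞) (n : ℕ) : 0 < eigenNormSq a n :=
  lt_of_lt_of_le (by norm_num) (half_le_eigenNormSq a n)

/-- The Poincaré inequality on the orthogonal complement of the first `n + 1` eigenfunctions. -/
theorem freq_sq_mul_massForm_le {a : ℝ≥0∞} (n : ℕ) {f : energySpace a}
    (hf : ∀ j : Fin (n + 1), massForm a f (eigenfun a j) = 0) :
    freq a n ^ 2 * massForm a f f ≤ energyForm a f f := by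
  -- The mesh is `1 / L`. In each case `n + 1` point constraints suffice: with `a = ⊤` both
  -- endpoints are free of charge and `L = n + 2`; otherwise the point `1` is itself a constraint
  -- and `L = n + 1`, which needs the strict bound `ω_n < (n + 1) π`.
  obtain ⟨L, hL0, hLn, hLt, hLf⟩ : ∃ L : ℕ, n + 1 ≤ L ∧ L ≤ n + 2 ∧
      freq a n < Real.pi * L ∧ (L = n + 2 → a = ⊤) := by
    by_cases ha : a = ⊤
    · refine ⟨n + 2, by omega, le_rfl, ?_, fun _ => ha⟩
      have := freq_upper a n
      push_cast
      nlinarith [Real.pi_pos]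
    · refine ⟨n + 1, le_rfl, by omega, ?_, fun h => by omega⟩
      have := freq_lt ha n
      push_cast
      linarith
  have hL : 0 < L := by omega
  have hω := freq_pos a n
  -- The midpoint leaves strict inequalities on both sides: the eigenvalues must lie below `κ²`, and
  -- Wirtinger needs `κ < π L`.
  set κ := (freq a n + Real.pi * L) / 2 with hκ
  have hκ1 : freq a n < κ := by linarith
  have hκ2 : κ < Real.pi * L := by linarith
  have hm0 : 0 ≤ massForm a f f := by
    rw [massForm_apply]
    exact intervalIntegral.integral_nonneg zero_le_one fun z _ => mul_self_nonneg _
  let ev : energySpace a →ₗ[ℝ] (Fin (n + 1) → ℝ) :=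
    { toFun := fun g j => (g : ℝ → ℝ) (((j : ℕ) + 1 : ℕ) / L)
      map_add' := fun g h => rfl
      map_smul' := fun c g => rfl }
  refine le_trans (b := κ ^ 2 * massForm a f f) (by gcongr) ?_
  refine form_le_energy_of_orthogonal (φ := fun j : Fin (n + 1) => eigenfun a j)
    (l := fun j => freq a j ^ 2) massForm_comm energyForm_comm
    (fun x j => energyForm_eigenfun x j)
    (fun i j hij => massForm_eigenfun_of_ne fun h => hij (Fin.ext h))
    (fun j => by rw [massForm_eigenfun_self]; exact eigenNormSq_pos a j) ev (fun j => ?_)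
    (fun g hg => ?_) hf
  · have h1 : freq a j ≤ freq a n := (freq_strictMono a).monotone (Nat.lt_succ_iff.1 j.2)
    have h2 := freq_pos a j
    exact pow_lt_pow_left₀ (by linarith) h2.le two_ne_zero
  · have h := wirtinger_grid (energySpace.hasDerivAt g) (energySpace.continuous_deriv g) hL (by linarith) hκ2 (fun k hk => ?_)
    · rw [massForm_apply, energyForm_apply]
      have hg1 : 0 ≤ a.toReal * ((g : ℝ → ℝ) 1 * (g : ℝ → ℝ) 1) :=
        mul_nonneg ENNReal.toReal_nonneg (mul_self_nonneg _)
      simp only [← sq] at hg1 ⊢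
      linarith
    · rcases Nat.eq_zero_or_pos k with h0 | h0
      · simpa [h0] using g.2.2.1
      · by_cases hk' : k ≤ n + 1
        · have h1 : (g : ℝ → ℝ) ((k - 1 + 1 : ℕ) / L) = 0 := congrFun hg ⟨k - 1, by omega⟩
          rwa [Nat.sub_add_cancel h0] at h1
        · have hkL : k = L := by omega
          have h1 := g.2.2.2 (hLf (by omega))
          have hL' : (L : ℝ) ≠ 0 := by exact_mod_cast hL.ne'
          rw [hkL, div_self hL']
          exact h1

/-! ### Eigenfunction expansions -/

/-- The Fourier coefficients with respect to the (not normalized) eigenfunctions. -/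
noncomputable def coeff (a : ℝ≥0∞) (f : ℝ → ℝ) (n : ℕ) : ℝ :=
  (∫ z in (0 : ℝ)..1, f z * Real.sin (freq a n * z)) / eigenNormSq a n

/-- The remainder is orthogonal to the first `n + 1` eigenfunctions and has no more energy than `f`,
so the spectral gap bounds its mass. -/
theorem integral_sub_partialSum_sq_le {a : ℝ≥0∞} (f : energySpace a) (n : ℕ) :
    ∫ z in (0 : ℝ)..1, ((f : ℝ → ℝ) z -
      ∑ j ∈ Finset.range (n + 1), coeff a f j * Real.sin (freq a j * z)) ^ 2 ≤
      energyForm a f f / freq a n ^ 2 := by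
  have hproj := energy_sub_projection_le (B := massForm a) (Q := energyForm a)
    (φ := fun j : Fin (n + 1) => eigenfun a j)
    (l := fun j => freq a j ^ 2) energyForm_comm
    (fun x j => energyForm_eigenfun x j)
    (fun i j hij => massForm_eigenfun_of_ne fun h => hij (Fin.ext h))
    (fun j => by rw [massForm_eigenfun_self]; exact eigenNormSq_pos a j)
    (fun j => sq_nonneg _) f (c := fun j => coeff a f j)
    (fun j => by rw [massForm_eigenfun_self]; rfl)
  have h := freq_sq_mul_massForm_le n hproj.1
  have hω := freq_pos a n
  rw [le_div_iff₀ (by positivity), mul_comm]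
  refine le_trans (le_of_eq ?_) (h.trans hproj.2)
  rw [massForm_apply]
  congr 1
  refine integral_congr fun z _ => ?_
  simp only [Submodule.coe_sub, Pi.sub_apply, Fintype.linearCombination_apply, ← sq]
  congr 2
  rw [Finset.sum_range, Submodule.coe_sum, Finset.sum_apply]
  rfl

theorem summable_inv_succ_sq : Summable fun n : ℕ => 1 / ((n : ℝ) + 1) ^ 2 := by
  have := (summable_nat_add_iff 1).2 (Real.summable_one_div_nat_pow.2 one_lt_two)
  simpa using this

theorem inv_freq_sq_le (a : ℝ≥0∞) (n : ℕ) : 1 / freq a n ^ 2 ≤ 1 / ((n : ℝ) + 1) ^ 2 := by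
  have := succ_le_freq a n
  gcongr

theorem summable_inv_freq_sq (a : ℝ≥0∞) : Summable fun n : ℕ => 1 / freq a n ^ 2 :=
  Summable.of_nonneg_of_le (fun n => by positivity) (inv_freq_sq_le a) summable_inv_succ_sq

theorem abs_coeff_le (a : ℝ≥0∞) {f : ℝ → ℝ} (hf : Continuous f) (n : ℕ) :
    |coeff a f n| ≤ 2 * ∫ z in (0 : ℝ)..1, |f z| := by
  have hN := half_le_eigenNormSq a n
  have hI : 0 ≤ ∫ z in (0 : ℝ)..1, |f z| :=
    intervalIntegral.integral_nonneg zero_le_one fun z _ => abs_nonneg _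
  have h : |∫ z in (0 : ℝ)..1, f z * Real.sin (freq a n * z)| ≤ ∫ z in (0 : ℝ)..1, |f z| := by
    refine (abs_integral_le_integral_abs zero_le_one).trans ?_
    refine integral_mono_on zero_le_one (Continuous.intervalIntegrable (by fun_prop) _ _)
      (hf.abs.intervalIntegrable _ _) fun z _ => ?_
    rw [abs_mul]
    exact mul_le_of_le_one_right (abs_nonneg _) (Real.abs_sin_le_one _)
  rw [coeff, abs_div, abs_of_pos (eigenNormSq_pos a n), div_le_iff₀ (eigenNormSq_pos a n)]
  nlinarith

/-- Green's identity against an eigenfunction: the exit contributes nothing, and only the inlet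
value of `f` survives. It gives the decay `ω_n⁻²` when `f 0 = 0`, and the coefficients of `ψ` and
`χ` without computing an integral. -/
theorem coeff_deriv_two {a : ℝ≥0∞} {f f' f'' : ℝ → ℝ} (hf : IsC2 f f' f'')
    (h1 : ExitBC a (f 1) (f' 1)) (n : ℕ) :
    coeff a f'' n = freq a n * f 0 / eigenNormSq a n - freq a n ^ 2 * coeff a f n := by
  have hs := isC2_sin_mul (freq a n)
  have hg := hf.integral_green hs
  have hfc := hf.continuous
  have hf''c := hf.continuous''
  have hw := h1.wronskian_eq_zero (exitBC_freq a n)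
  simp only [mul_one, mul_zero, Real.sin_zero, Real.cos_zero] at hg
  rw [hw, integral_sub (Continuous.intervalIntegrable (by fun_prop) _ _)
    (Continuous.intervalIntegrable (by fun_prop) _ _)] at hg
  have e : ∫ z in (0 : ℝ)..1, f z * (-freq a n ^ 2 * Real.sin (freq a n * z)) =
      -freq a n ^ 2 * ∫ z in (0 : ℝ)..1, f z * Real.sin (freq a n * z) := by
    rw [← intervalIntegral.integral_const_mul]
    exact integral_congr fun z _ => by ring
  rw [e] at hg
  have : ∫ z in (0 : ℝ)..1, f'' z * Real.sin (freq a n * z) = freq a n * f 0 -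
      freq a n ^ 2 * ∫ z in (0 : ℝ)..1, f z * Real.sin (freq a n * z) := by linarith
  rw [coeff, coeff, this]
  ring

theorem abs_coeff_le_div {a : ℝ≥0∞} {f f' f'' : ℝ → ℝ} (hf : IsC2 f f' f'') (h0 : f 0 = 0)
    (h1 : ExitBC a (f 1) (f' 1)) (n : ℕ) :
    |coeff a f n| ≤ (2 * ∫ z in (0 : ℝ)..1, |f'' z|) * (1 / freq a n ^ 2) := by
  have hω := freq_pos a n
  have h := abs_coeff_le a hf.continuous'' n
  rw [coeff_deriv_two hf h1, h0, mul_zero, zero_div, zero_sub, abs_neg, abs_mul,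
    abs_of_pos (by positivity : 0 < freq a n ^ 2)] at h
  rw [mul_one_div, le_div_iff₀ (by positivity), mul_comm]
  exact h

theorem summable_abs_coeff {a : ℝ≥0∞} {f f' f'' : ℝ → ℝ} (hf : IsC2 f f' f'') (h0 : f 0 = 0)
    (h1 : ExitBC a (f 1) (f' 1)) : Summable fun n => |coeff a f n| :=
  Summable.of_nonneg_of_le (fun _ => abs_nonneg _) (abs_coeff_le_div hf h0 h1)
    ((summable_inv_freq_sq a).mul_left _)

theorem abs_mul_sin_le (b x : ℝ) : |b * Real.sin x| ≤ |b| := by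
  rw [abs_mul]; exact mul_le_of_le_one_right (abs_nonneg _) (Real.abs_sin_le_one _)

theorem abs_mul_cos_le (b x : ℝ) : |b * Real.cos x| ≤ |b| := by
  rw [abs_mul]; exact mul_le_of_le_one_right (abs_nonneg _) (Real.abs_cos_le_one _)

/-- A `C²` function with the boundary conditions is the sum of its eigenfunction expansion. -/
theorem eq_tsum_coeff {a : ℝ≥0∞} {f f' f'' : ℝ → ℝ} (hf : IsC2 f f' f'') (h0 : f 0 = 0)
    (h1 : ExitBC a (f 1) (f' 1)) {z : ℝ} (hz : z ∈ Icc (0 : ℝ) 1) :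
    f z = ∑' n, coeff a f n * Real.sin (freq a n * z) := by
  have hsum := summable_abs_coeff hf h0 h1
  set S : ℝ → ℝ := fun z => ∑' n, coeff a f n * Real.sin (freq a n * z) with hS
  have hbound : ∀ (n : ℕ) (z : ℝ), ‖coeff a f n * Real.sin (freq a n * z)‖ ≤ |coeff a f n| :=
    fun n z => abs_mul_sin_le _ _
  have hSc : Continuous S := continuous_tsum (fun n => by fun_prop) hsum hbound
  have hsz : ∀ z, Summable fun n => coeff a f n * Real.sin (freq a n * z) := fun z =>
    Summable.of_norm_bounded hsum fun n => hbound n z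
  have hfc := hf.continuous
  let F : energySpace a := ⟨f, hf.contDiff_two.of_le (by norm_num), h0, h1.1⟩
  set P : ℕ → ℝ → ℝ := fun n z =>
    ∑ j ∈ Finset.range (n + 1), coeff a f j * Real.sin (freq a j * z) with hP
  have hPle : ∀ n z, |P n z| ≤ ∑' n, |coeff a f n| := fun n z =>
    (Finset.abs_sum_le_sum_abs _ _).trans ((Finset.sum_le_sum fun j _ => hbound j z).trans
      (hsum.sum_le_tsum _ fun _ _ => abs_nonneg _))
  -- The partial sums converge uniformly to a continuous `S`, so their `L²` distances to `f` tend to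
  -- that of `S`; the spectral gap sends these distances to zero. Continuity then gives equality at
  -- every point.
  have hlim1 : Tendsto (fun n => ∫ z in (0 : ℝ)..1, (f z - P n z) ^ 2) atTop
      (𝓝 (∫ z in (0 : ℝ)..1, (f z - S z) ^ 2)) := by
    refine intervalIntegral.tendsto_integral_filter_of_dominated_convergence
      (fun z => (|f z| + ∑' n, |coeff a f n|) ^ 2) ?_ ?_ ?_ ?_
    · exact Eventually.of_forall fun n => Continuous.aestronglyMeasurable (by fun_prop)
    · refine Eventually.of_forall fun n => Eventually.of_forall fun z _ => ?_
      rw [Real.norm_eq_abs, abs_pow]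
      have h2 := hPle n z
      have h3 : |f z - P n z| ≤ |f z| + |P n z| := abs_sub _ _
      gcongr
      linarith
    · exact Continuous.intervalIntegrable (by fun_prop) _ _
    · refine Eventually.of_forall fun z _ => ?_
      have h2 := ((hsz z).hasSum.tendsto_sum_nat).comp (tendsto_add_atTop_nat 1)
      exact (tendsto_const_nhds.sub h2).pow 2
  have hlim2 : Tendsto (fun n => energyForm a F F / freq a n ^ 2) atTop (𝓝 0) := by
    have := ((summable_inv_freq_sq a).tendsto_atTop_zero).const_mul (energyForm a F F)
    simpa [div_eq_mul_inv] using this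
  have hle : ∫ z in (0 : ℝ)..1, (f z - S z) ^ 2 ≤ 0 :=
    le_of_tendsto_of_tendsto' hlim1 hlim2 fun n => integral_sub_partialSum_sq_le F n
  by_contra hne
  have hpos : 0 < ∫ z in (0 : ℝ)..1, (f z - S z) ^ 2 := by
    refine intervalIntegral.integral_pos zero_lt_one (by fun_prop) (fun z _ => sq_nonneg _)
      ⟨z, hz, ?_⟩
    have : f z - S z ≠ 0 := sub_ne_zero.2 hne
    positivity
  linarith

/-! ### Termwise differentiation of sine series -/

section Series

variable {a : ℝ≥0∞} {b : ℕ → ℝ}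

theorem le_freq_mul (x : ℝ) (hx : 0 ≤ x) (n : ℕ) : x ≤ x * freq a n := by
  have h1 := succ_le_freq a n
  have hn : (0 : ℝ) ≤ n := n.cast_nonneg
  nlinarith

theorem summable_of_mul_freq (h : Summable fun n => |b n| * freq a n) :
    Summable fun n => |b n| :=
  Summable.of_nonneg_of_le (fun _ => abs_nonneg _) (fun n => le_freq_mul _ (abs_nonneg _) n) h

theorem hasDerivAt_sineSeries (h : Summable fun n => |b n| * freq a n) (z : ℝ) :
    HasDerivAt (fun z => ∑' n, b n * Real.sin (freq a n * z))
      (∑' n, b n * freq a n * Real.cos (freq a n * z)) z := by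
  refine hasDerivAt_tsum (g := fun n z => b n * Real.sin (freq a n * z))
    (g' := fun n z => b n * freq a n * Real.cos (freq a n * z)) (y₀ := 0) h
    (fun n y => ?_) (fun n y => ?_) ?_ z
  · exact (((isC2_sin_mul (freq a n)).hasDerivAt y).const_mul (b n)).congr_deriv (by ring)
  · refine (abs_mul_cos_le _ _).trans ?_
    rw [abs_mul, abs_of_pos (freq_pos a n)]
  · simp

theorem hasDerivAt_cosineSeries (h : Summable fun n => |b n| * freq a n ^ 2) (z : ℝ) :
    HasDerivAt (fun z => ∑' n, b n * freq a n * Real.cos (freq a n * z))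
      (∑' n, -(b n * freq a n ^ 2 * Real.sin (freq a n * z))) z := by
  refine hasDerivAt_tsum (g := fun n z => b n * freq a n * Real.cos (freq a n * z))
    (g' := fun n z => -(b n * freq a n ^ 2 * Real.sin (freq a n * z))) (y₀ := 0) h
    (fun n y => ?_) (fun n y => ?_) ?_ z
  · exact (((isC2_sin_mul (freq a n)).hasDerivAt' y).const_mul (b n)).congr_deriv (by ring)
      |>.congr_of_eventuallyEq (Eventually.of_forall fun x => by ring)
  · rw [norm_neg]
    refine (abs_mul_sin_le _ _).trans ?_
    rw [abs_mul, abs_of_pos (pow_pos (freq_pos a n) 2)]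
  · have : Summable fun n => |b n| * freq a n := by
      refine Summable.of_nonneg_of_le (fun n => mul_nonneg (abs_nonneg _) (freq_pos a n).le)
        (fun n => ?_) h
      rw [pow_two, ← mul_assoc]
      exact le_freq_mul _ (mul_nonneg (abs_nonneg _) (freq_pos a n).le) n
    refine Summable.of_norm_bounded this fun n => (abs_mul_cos_le _ _).trans ?_
    rw [abs_mul, abs_of_pos (freq_pos a n)]

theorem summable_mul_freq (h : Summable fun n => |b n| * freq a n ^ 2) :
    Summable fun n => |b n| * freq a n := by
  refine Summable.of_nonneg_of_le (fun n => mul_nonneg (abs_nonneg _) (freq_pos a n).le)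
    (fun n => ?_) h
  rw [pow_two, ← mul_assoc]
  exact le_freq_mul _ (mul_nonneg (abs_nonneg _) (freq_pos a n).le) n

theorem isC2_sineSeries (h : Summable fun n => |b n| * freq a n ^ 2) :
    IsC2 (fun z => ∑' n, b n * Real.sin (freq a n * z))
      (fun z => ∑' n, b n * freq a n * Real.cos (freq a n * z))
      (fun z => ∑' n, -(b n * freq a n ^ 2 * Real.sin (freq a n * z))) := by
  refine ⟨hasDerivAt_sineSeries (summable_mul_freq h), hasDerivAt_cosineSeries h, ?_⟩
  refine continuous_tsum (fun n => by fun_prop) h fun n z => ?_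
  rw [norm_neg]
  refine (abs_mul_sin_le _ _).trans ?_
  rw [abs_mul, abs_of_pos (pow_pos (freq_pos a n) 2)]

theorem exitBC_sineSeries (a : ℝ≥0∞) (b : ℕ → ℝ) :
    ExitBC a (∑' n, b n * Real.sin (freq a n * 1))
      (∑' n, b n * freq a n * Real.cos (freq a n * 1)) := by
  refine ⟨fun ha => ?_, fun ha => ?_⟩
  · simp [(exitBC_freq a _).1 ha]
  · rw [← tsum_mul_left]
    refine tsum_congr fun n => ?_
    have := (exitBC_freq a n).2 ha
    rw [mul_one]
    linear_combination b n * this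

end Series

/-! ### The series for the gain -/

theorem coeff_steadyState {ζ : ℝ} (hζ : 0 < ζ) (a : ℝ≥0∞) (n : ℕ) :
    coeff a (steadyState ζ a) n = freq a n / ((ζ ^ 2 + freq a n ^ 2) * eigenNormSq a n) := by
  have hψ := isSteady_steadyState hζ a
  have h := coeff_deriv_two hψ.isC2 hψ.exit n
  have hN := eigenNormSq_pos a n
  have hω := freq_pos a n
  have e : coeff a (fun z => ζ ^ 2 * steadyState ζ a z) n = ζ ^ 2 * coeff a (steadyState ζ a) n := by
    unfold coeff
    rw [← mul_div_assoc, ← intervalIntegral.integral_const_mul]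
    congr 1
    exact integral_congr fun z _ => by ring
  rw [e, hψ.inlet] at h
  rw [eq_div_iff (by positivity)]
  field_simp at h
  linarith

theorem coeff_secondary {ζ : ℝ} (hζ : 0 < ζ) {a : ℝ≥0∞} {χ χ' χ'' : ℝ → ℝ} (hχ : IsC2 χ χ' χ'')
    (heq : ∀ z, χ'' z = ζ ^ 2 * χ z + steadyState ζ a z) (h0 : χ 0 = 0)
    (h1 : ExitBC a (χ 1) (χ' 1)) (n : ℕ) :
    coeff a χ n = -(freq a n / ((ζ ^ 2 + freq a n ^ 2) ^ 2 * eigenNormSq a n)) := by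
  have h := coeff_deriv_two hχ h1 n
  have hN := eigenNormSq_pos a n
  have hω := freq_pos a n
  have hψc := (isSteady_steadyState hζ a).isC2.continuous
  have hχc := hχ.continuous
  have e : coeff a χ'' n = ζ ^ 2 * coeff a χ n + coeff a (steadyState ζ a) n := by
    unfold coeff
    rw [← mul_div_assoc, ← intervalIntegral.integral_const_mul, ← add_div,
      ← integral_add (Continuous.intervalIntegrable (by fun_prop) _ _)
      (Continuous.intervalIntegrable (by fun_prop) _ _)]
    congr 1
    exact integral_congr fun z _ => by simp only [heq]; ring
  rw [e, h0, coeff_steadyState hζ] at h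
  have h2 : (ζ ^ 2 + freq a n ^ 2) * coeff a χ n =
      -(freq a n / ((ζ ^ 2 + freq a n ^ 2) * eigenNormSq a n)) := by
    rw [mul_zero, zero_div] at h
    linarith
  have hp : 0 < ζ ^ 2 + freq a n ^ 2 := by positivity
  rw [← mul_right_inj' hp.ne', h2]
  field_simp

/-- The coefficients of `χ` are of order `ω_n⁻³`, against `ω_n⁻¹` for `ψ`; this is what allows the
series of `χ` to be differentiated once. -/
theorem summable_secondary_mul_freq {ζ : ℝ} (hζ : 0 < ζ) {a : ℝ≥0∞} {χ χ' χ'' : ℝ → ℝ}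
    (hχ : IsC2 χ χ' χ'')
    (heq : ∀ z, χ'' z = ζ ^ 2 * χ z + steadyState ζ a z) (h0 : χ 0 = 0)
    (h1 : ExitBC a (χ 1) (χ' 1)) : Summable fun n => |coeff a χ n| * freq a n := by
  refine Summable.of_nonneg_of_le (fun n => mul_nonneg (abs_nonneg _) (freq_pos a n).le)
    (fun n => ?_) ((summable_inv_freq_sq a).mul_left 2)
  have hN := half_le_eigenNormSq a n
  have hN' := eigenNormSq_pos a n
  have hω := freq_pos a n
  rw [coeff_secondary hζ hχ heq h0 h1, abs_neg, abs_of_pos (by positivity), div_mul_eq_mul_div,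
    mul_one_div, div_le_div_iff₀ (by positivity) (by positivity)]
  have h3 : freq a n ^ 2 * freq a n ^ 2 ≤ (ζ ^ 2 + freq a n ^ 2) ^ 2 := by
    nlinarith [sq_nonneg ζ, sq_nonneg (freq a n), mul_nonneg (sq_nonneg ζ) (sq_nonneg (freq a n)),
      mul_nonneg (sq_nonneg ζ) (sq_nonneg ζ)]
  calc freq a n * freq a n * freq a n ^ 2 = freq a n ^ 2 * freq a n ^ 2 := by ring
    _ ≤ (ζ ^ 2 + freq a n ^ 2) ^ 2 := h3
    _ ≤ 2 * ((ζ ^ 2 + freq a n ^ 2) ^ 2 * eigenNormSq a n) := by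
      nlinarith [sq_nonneg (ζ ^ 2 + freq a n ^ 2)]

theorem gainTerm_eq {ζ : ℝ} (hζ : 0 < ζ) (a : ℝ≥0∞) (n : ℕ) :
    2 / Real.pi ^ 2 * gainTerm ζ a (n + 1) =
      freq a n ^ 2 / ((ζ ^ 2 + freq a n ^ 2) ^ 2 * eigenNormSq a n) := by
  have hω := freq_pos a n
  have hpi := Real.pi_pos
  have hN := eigenNormSq_pos a n
  set x : ℝ := ((n + 1 : ℕ) : ℝ) - mu (n + 1) a with hx
  have hωx : freq a n = x * Real.pi := rfl
  have hx0 : 0 < x := by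
    rw [hωx] at hω
    exact pos_of_mul_pos_left hω hpi.le
  have e1 : x + (2 * Real.pi)⁻¹ * Real.sin (2 * mu (n + 1) a * Real.pi) =
      2 * x * eigenNormSq a n := by
    rw [eigenNormSq, hωx]
    field_simp
    ring
  rw [gainTerm, ← hx, e1, hωx]
  field_simp

/-- Replaces Parseval's identity for `ψ`, which does not vanish at the inlet: its squared norm is
read off as `-χ'(0)`. -/
theorem summable_gainTerm_and_gain {ζ : ℝ} (hζ : 0 < ζ) (a : ℝ≥0∞) :
    Summable (fun n : ℕ => gainTerm ζ a (n + 1)) ∧ gain ζ a = gainClosedForm ζ a := by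
  obtain ⟨χ, χ', χ'', hχ, heq, h0, h1⟩ := exists_secondary hζ a
  have hψ := isSteady_steadyState hζ a
  have hpi := Real.pi_pos
  have hsum := summable_secondary_mul_freq hζ hχ heq h0 h1
  have hterm : ∀ n, gainTerm ζ a (n + 1) =
      Real.pi ^ 2 / 2 * -(coeff a χ n * freq a n * Real.cos (freq a n * 0)) := by
    intro n
    have h := gainTerm_eq hζ a n
    have e : -(coeff a χ n * freq a n * Real.cos (freq a n * 0)) =
        freq a n ^ 2 / ((ζ ^ 2 + freq a n ^ 2) ^ 2 * eigenNormSq a n) := by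
      rw [coeff_secondary hζ hχ heq h0 h1, mul_zero, Real.cos_zero]; ring
    rw [e, ← h]
    field_simp
  have hsum' : Summable fun n => coeff a χ n * freq a n * Real.cos (freq a n * 0) :=
    Summable.of_norm_bounded hsum fun n => (abs_mul_cos_le _ _).trans (by
      rw [abs_mul, abs_of_pos (freq_pos a n)])
  have hd : χ' 0 = ∑' n, coeff a χ n * freq a n * Real.cos (freq a n * 0) := by
    -- The expansion equals `χ` only on `[0, 1]`, so the derivatives at the endpoint `0` are
    -- compared within that interval.
    have hu : UniqueDiffWithinAt ℝ (Icc (0 : ℝ) 1) 0 := uniqueDiffOn_Icc zero_lt_one 0 (by simp)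
    have d1 := (hχ.hasDerivAt 0).hasDerivWithinAt (s := Icc 0 1)
    have d2 := (hasDerivAt_sineSeries hsum 0).hasDerivWithinAt (s := Icc 0 1)
    have d3 := d2.congr (fun z hz => eq_tsum_coeff hχ h0 h1 hz)
      (eq_tsum_coeff hχ h0 h1 (by simp))
    exact hu.eq_deriv _ d1 d3
  have hnorm : ∫ z in (0 : ℝ)..1, steadyState ζ a z ^ 2 = -χ' 0 := by
    have hg := hχ.integral_green hψ.isC2
    rw [h1.wronskian_eq_zero hψ.exit, h0, hψ.inlet] at hg
    calc ∫ z in (0 : ℝ)..1, steadyState ζ a z ^ 2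
        = ∫ z in (0 : ℝ)..1, (χ'' z * steadyState ζ a z -
            χ z * (ζ ^ 2 * steadyState ζ a z)) :=
          integral_congr fun z _ => by simp only [heq]; ring
      _ = -χ' 0 := by rw [hg]; ring
  refine ⟨?_, ?_⟩
  · simp only [hterm]
    exact hsum'.neg.mul_left _
  · rw [← sqrt_integral_steadyState_sq hζ, hnorm, gain]
    simp only [hterm]
    rw [tsum_mul_left, tsum_neg, ← hd]
    have e : Real.sqrt 2 / Real.pi = Real.sqrt (2 / Real.pi ^ 2) := by
      rw [Real.sqrt_div zero_le_two, Real.sqrt_sq hpi.le]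
    rw [e, ← Real.sqrt_mul (by positivity)]
    congr 1
    field_simp

/-! ### Sums of modes and existence without drift -/

/-- A function of two variables with continuous partial derivatives on an open set is `C¹`. -/
theorem contDiffOn_one_of_partials {s : Set (ℝ × ℝ)} (hs : IsOpen s) {f p q : ℝ → ℝ → ℝ}
    (hp : ∀ x ∈ s, HasDerivAt (fun t => f t x.2) (p x.1 x.2) x.1)
    (hq : ∀ x ∈ s, HasDerivAt (fun z => f x.1 z) (q x.1 x.2) x.2)
    (hpc : ContinuousOn (fun x : ℝ × ℝ => p x.1 x.2) s)
    (hqc : ContinuousOn (fun x : ℝ × ℝ => q x.1 x.2) s) :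
    ContDiffOn ℝ 1 (fun x : ℝ × ℝ => f x.1 x.2) s := by
  have e : (1 : WithTop ℕ∞) = 0 + 1 := by norm_num
  rw [e, contDiffOn_succ_iff_hasFDerivWithinAt_of_uniqueDiffOn hs.uniqueDiffOn]
  refine ⟨by simp, fun x => p x.1 x.2 • ContinuousLinearMap.fst ℝ ℝ ℝ +
    q x.1 x.2 • ContinuousLinearMap.snd ℝ ℝ ℝ, ?_, fun x hx => ?_⟩
  · rw [contDiffOn_zero]
    exact (hpc.smul continuousOn_const).add (hqc.smul continuousOn_const)
  · have hn := hs.mem_nhds hx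
    have hspan : Continuous fun c : ℝ => ContinuousLinearMap.toSpanSingleton ℝ c :=
      (ContinuousLinearMap.toSpanSingletonCLE (𝕜 := ℝ) (E := ℝ)).continuous
    have h := hasStrictFDerivAt_uncurry_coprod (𝕜 := ℝ) (u := x) (f := f)
      (f₁ := fun t z => ContinuousLinearMap.toSpanSingleton ℝ (p t z))
      (f₂ := fun t z => ContinuousLinearMap.toSpanSingleton ℝ (q t z))
      (by filter_upwards [hn] with y hy using (hp y hy).hasFDerivAt)
      (by filter_upwards [hn] with y hy using (hq y hy).hasFDerivAt)
      (hspan.continuousAt.comp (hpc.continuousAt hn))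
      (hspan.continuousAt.comp (hqc.continuousAt hn))
    refine (h.hasFDerivAt.congr_fderiv ?_).hasFDerivWithinAt
    ext <;> simp [Function.HasUncurry.uncurry]

/-- The solution of `A' = -l A + e g`, `A(0) = b`. -/
noncomputable def modal (l b e : ℝ) (g : ℝ → ℝ) (t : ℝ) : ℝ :=
  b * Real.exp (-l * t) + e * (Real.exp (-l * t) * ∫ s in (0 : ℝ)..t, Real.exp (l * s) * g s)

theorem modal_zero (l b e : ℝ) (g : ℝ → ℝ) : modal l b e g 0 = b := by simp [modal]

theorem hasDerivAt_modal (l b e : ℝ) {g : ℝ → ℝ} (hg : Continuous g) (t : ℝ) :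
    HasDerivAt (modal l b e g) (-l * modal l b e g t + e * g t) t := by
  have hc : Continuous fun s => Real.exp (l * s) * g s := by fun_prop
  have h1 := (isC2_exp (-l)).hasDerivAt t
  have h2 : HasDerivAt (fun t => ∫ s in (0 : ℝ)..t, Real.exp (l * s) * g s)
      (Real.exp (l * t) * g t) t :=
    integral_hasDerivAt_right (hc.intervalIntegrable _ _) (hc.stronglyMeasurableAtFilter _ _)
      hc.continuousAt
  refine ((h1.const_mul b).add ((h1.mul h2).const_mul e)).congr_deriv ?_
  have h3 : Real.exp (-l * t) * Real.exp (l * t) = 1 := by rw [← Real.exp_add]; simp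
  simp only [modal]
  linear_combination e * g t * h3

theorem continuous_modal (l b e : ℝ) {g : ℝ → ℝ} (hg : Continuous g) :
    Continuous (modal l b e g) :=
  continuous_iff_continuousAt.2 fun t => (hasDerivAt_modal l b e hg t).continuousAt

/-- Since `l ∫₀ᵗ exp (-l (t - s)) ds ≤ 1`, the Duhamel term gains a full factor `l`, uniformly in
`l`. This gain pays for two space derivatives or one time derivative. -/
theorem mul_abs_duhamel_le {l G t : ℝ} {g : ℝ → ℝ} (hg : Continuous g) (hl : 0 < l)
    (ht : 0 ≤ t) (hG : ∀ s ∈ Icc 0 t, |g s| ≤ G) :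
    l * |Real.exp (-l * t) * ∫ s in (0 : ℝ)..t, Real.exp (l * s) * g s| ≤ G := by
  have hG0 : 0 ≤ G := (abs_nonneg _).trans (hG 0 ⟨le_rfl, ht⟩)
  have hI : ∫ s in (0 : ℝ)..t, l * Real.exp (l * s) * G = (Real.exp (l * t) - 1) * G := by
    rw [integral_eq_sub_of_hasDerivAt (f := fun s => Real.exp (l * s) * G)
      (fun s _ => ((isC2_exp l).hasDerivAt s).mul_const G)
      (Continuous.intervalIntegrable (by fun_prop) _ _)]
    simp; ring
  have h1 : l * |∫ s in (0 : ℝ)..t, Real.exp (l * s) * g s| ≤ (Real.exp (l * t) - 1) * G := by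
    rw [← hI, ← abs_of_pos hl, ← abs_mul, abs_of_pos hl, ← intervalIntegral.integral_const_mul]
    refine (abs_integral_le_integral_abs ht).trans ?_
    refine integral_mono_on ht (Continuous.intervalIntegrable (by fun_prop) _ _)
      (Continuous.intervalIntegrable (by fun_prop) _ _) fun s hs => ?_
    rw [abs_mul, abs_mul, abs_of_pos hl, abs_of_pos (Real.exp_pos _), ← mul_assoc]
    have := hG s hs
    gcongr
  have h2 : Real.exp (-l * t) * Real.exp (l * t) = 1 := by rw [← Real.exp_add]; simp
  have h3 := Real.exp_pos (-l * t)
  rw [abs_mul, abs_of_pos h3, mul_left_comm]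
  have h4 := mul_le_mul_of_nonneg_left h1 h3.le
  have h5 : Real.exp (-l * t) * ((Real.exp (l * t) - 1) * G) = G - Real.exp (-l * t) * G := by
    linear_combination G * h2
  have h6 := mul_nonneg h3.le hG0
  linarith

theorem abs_modal_le {l b e G t : ℝ} {g : ℝ → ℝ} (hg : Continuous g) (hl : 0 < l)
    (ht : 0 ≤ t) (hG : ∀ s ∈ Icc 0 t, |g s| ≤ G) :
    |modal l b e g t| ≤ |b| + |e| * (G / l) := by
  have h1 := mul_abs_duhamel_le hg hl ht hG
  rw [mul_comm, ← le_div_iff₀ hl] at h1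
  refine (abs_add_le _ _).trans (add_le_add ?_ ?_)
  · rw [abs_mul, abs_of_pos (Real.exp_pos _)]
    exact mul_le_of_le_one_right (abs_nonneg _) (Real.exp_le_one_iff.2 (by nlinarith))
  · rw [abs_mul]
    gcongr

/-- The initial part obeys `l exp (-l t) ≤ 1 / τ` for `t ≥ τ`; the bound is lost as `τ → 0`, so
derivatives are controlled for positive times only. -/
theorem mul_abs_modal_le {l b e G t τ : ℝ} {g : ℝ → ℝ} (hg : Continuous g) (hl : 0 < l)
    (hτ : 0 < τ) (ht : τ ≤ t) (hG : ∀ s ∈ Icc 0 t, |g s| ≤ G) :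
    l * |modal l b e g t| ≤ |b| / τ + |e| * G := by
  have h1 := mul_abs_duhamel_le hg hl (hτ.le.trans ht) hG
  have h2 : l * Real.exp (-l * t) ≤ 1 / τ := by
    have h3 : l * τ ≤ Real.exp (l * t) :=
      (mul_le_mul_of_nonneg_left ht hl.le).trans ((by linarith [Real.add_one_le_exp (l * t)]))
    have h4 : Real.exp (-l * t) * Real.exp (l * t) = 1 := by rw [← Real.exp_add]; simp
    have h5 := mul_le_mul_of_nonneg_left h3 (Real.exp_pos (-l * t)).le
    rw [le_div_iff₀ hτ]
    linarith
  calc l * |modal l b e g t|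
      ≤ l * (|b * Real.exp (-l * t)| +
        |e * (Real.exp (-l * t) * ∫ s in (0 : ℝ)..t, Real.exp (l * s) * g s)|) :=
        mul_le_mul_of_nonneg_left (abs_add_le _ _) hl.le
    _ = |b| * (l * Real.exp (-l * t)) +
        |e| * (l * |Real.exp (-l * t) * ∫ s in (0 : ℝ)..t, Real.exp (l * s) * g s|) := by
        rw [abs_mul b, abs_mul e, abs_of_pos (Real.exp_pos (-l * t))]; ring
    _ ≤ |b| * (1 / τ) + |e| * G := by gcongr
    _ = |b| / τ + |e| * G := by ring

/-- The decay rate of the `n`-th mode. -/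
noncomputable def rate (D ζ : ℝ) (a : ℝ≥0∞) (n : ℕ) : ℝ := D * (ζ ^ 2 + freq a n ^ 2)

section Modes

variable {D ζ : ℝ} {a : ℝ≥0∞} {b e : ℕ → ℝ} {g : ℝ → ℝ}

theorem rate_pos (hD : 0 < D) (ζ : ℝ) (a : ℝ≥0∞) (n : ℕ) : 0 < rate D ζ a n := by
  have := freq_pos a n
  unfold rate
  positivity

/-- Superposition of the modes. -/
noncomputable def modeSum (D ζ : ℝ) (a : ℝ≥0∞) (b e : ℕ → ℝ) (g : ℝ → ℝ) (t z : ℝ) : ℝ :=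
  ∑' n, modal (rate D ζ a n) (b n) (e n) g t * Real.sin (freq a n * z)

/-- The time derivative of `modeSum`. -/
noncomputable def modeSumDeriv (D ζ : ℝ) (a : ℝ≥0∞) (b e : ℕ → ℝ) (g : ℝ → ℝ) (t z : ℝ) : ℝ :=
  ∑' n, (-rate D ζ a n * modal (rate D ζ a n) (b n) (e n) g t + e n * g t) *
    Real.sin (freq a n * z)

theorem exists_bound_Icc (hg : Continuous g) (T : ℝ) : ∃ G, ∀ s ∈ Icc 0 T, |g s| ≤ G :=
  isCompact_Icc.exists_bound_of_continuousOn hg.continuousOn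

theorem continuousOn_modeSum (hD : 0 < D) (hb : Summable fun n => |b n|)
    (he : Summable fun n => |e n|) (hg : Continuous g) :
    ContinuousOn (fun q : ℝ × ℝ => modeSum D ζ a b e g q.1 q.2) (Ici 0 ×ˢ univ) := by
  refine continuousOn_of_locally_continuousOn fun x hx => ?_
  obtain ⟨G, hG⟩ := exists_bound_Icc hg (x.1 + 1)
  have hG0 : 0 ≤ G := (abs_nonneg _).trans (hG 0 ⟨le_rfl, by linarith [mem_Ici.1 hx.1]⟩)
  refine ⟨Iio (x.1 + 1) ×ˢ univ, isOpen_Iio.prod isOpen_univ, ⟨by simp, mem_univ _⟩, ?_⟩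
  refine continuousOn_tsum (u := fun n => |b n| + |e n| * (G / D)) (fun n => ?_)
    (hb.add (he.mul_right _)) fun n y hy => ?_
  · have := continuous_modal (rate D ζ a n) (b n) (e n) hg
    fun_prop
  · refine (abs_mul_sin_le _ _).trans ((abs_modal_le hg (rate_pos hD ζ a n) hy.1.1
      fun s hs => hG s ⟨hs.1, hs.2.trans (le_of_lt hy.2.1)⟩).trans ?_)
    -- All frequencies are at least `1`, so the rates are bounded below uniformly in `n`.
    have h1 : D ≤ rate D ζ a n := by
      have h2 := succ_le_freq a n
      have h3 : (1 : ℝ) ≤ freq a n := by linarith [(n.cast_nonneg : (0 : ℝ) ≤ n)]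
      exact le_mul_of_one_le_right hD.le (by nlinarith [sq_nonneg ζ])
    gcongr

theorem abs_modalDeriv_le (hD : 0 < D) (ζ : ℝ) (a : ℝ≥0∞) (hg : Continuous g) {τ t G : ℝ}
    (hτ : 0 < τ) (ht : τ ≤ t) (hG : ∀ s ∈ Icc 0 t, |g s| ≤ G) (n : ℕ) :
    |-rate D ζ a n * modal (rate D ζ a n) (b n) (e n) g t + e n * g t| ≤
      |b n| / τ + 2 * (|e n| * G) := by
  have h1 := mul_abs_modal_le (b := b n) (e := e n) hg (rate_pos hD ζ a n) hτ ht hG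
  refine (abs_add_le _ _).trans ?_
  rw [abs_mul, abs_mul, abs_neg, abs_of_pos (rate_pos hD ζ a n)]
  have h2 := mul_le_mul_of_nonneg_left (hG t ⟨hτ.le.trans ht, le_rfl⟩) (abs_nonneg (e n))
  linarith

theorem abs_modal_mul_freq_sq_le (hD : 0 < D) (ζ : ℝ) (a : ℝ≥0∞) (hg : Continuous g) {τ t G : ℝ}
    (hτ : 0 < τ) (ht : τ ≤ t) (hG : ∀ s ∈ Icc 0 t, |g s| ≤ G) (n : ℕ) :
    |modal (rate D ζ a n) (b n) (e n) g t| * freq a n ^ 2 ≤ (|b n| / τ + |e n| * G) / D := by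
  have h1 := mul_abs_modal_le (b := b n) (e := e n) hg (rate_pos hD ζ a n) hτ ht hG
  rw [le_div_iff₀ hD]
  refine le_trans ?_ h1
  unfold rate
  nlinarith [mul_nonneg (mul_nonneg hD.le (sq_nonneg ζ))
    (abs_nonneg (modal (D * (ζ ^ 2 + freq a n ^ 2)) (b n) (e n) g t))]

theorem summable_modal_mul_freq_sq (hD : 0 < D) (hb : Summable fun n => |b n|)
    (he : Summable fun n => |e n|) (hg : Continuous g) {t : ℝ} (ht : 0 < t) :
    Summable fun n => |modal (rate D ζ a n) (b n) (e n) g t| * freq a n ^ 2 := by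
  obtain ⟨G, hG⟩ := exists_bound_Icc hg t
  exact Summable.of_nonneg_of_le (fun n => by positivity)
    (abs_modal_mul_freq_sq_le hD ζ a hg ht le_rfl hG)
    (((hb.div_const t).add (he.mul_right G)).div_const D)

theorem hasDerivAt_modeSum (hD : 0 < D) (hb : Summable fun n => |b n|)
    (he : Summable fun n => |e n|) (hg : Continuous g) {t : ℝ} (ht : 0 < t) (z : ℝ) :
    HasDerivAt (fun t => modeSum D ζ a b e g t z) (modeSumDeriv D ζ a b e g t z) t := by
  obtain ⟨G, hG⟩ := exists_bound_Icc hg (t + 1)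
  have hmem : t ∈ Ioo (t / 2) (t + 1) := ⟨by linarith, by linarith⟩
  refine hasDerivAt_tsum_of_isPreconnected (t := Ioo (t / 2) (t + 1)) (y₀ := t)
    (g := fun n t => modal (rate D ζ a n) (b n) (e n) g t * Real.sin (freq a n * z))
    (g' := fun n t => (-rate D ζ a n * modal (rate D ζ a n) (b n) (e n) g t + e n * g t) *
      Real.sin (freq a n * z))
    ((hb.div_const (t / 2)).add ((he.mul_right G).mul_left 2)) isOpen_Ioo isPreconnected_Ioo
    (fun n s _ => (hasDerivAt_modal _ _ _ hg s).mul_const _) (fun n s hs => ?_) hmem ?_ hmem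
  · exact (abs_mul_sin_le _ _).trans (abs_modalDeriv_le hD ζ a hg (by linarith) hs.1.le
      (fun r hr => hG r ⟨hr.1, hr.2.trans hs.2.le⟩) n)
  · exact Summable.of_norm_bounded (summable_of_mul_freq (summable_mul_freq
      (summable_modal_mul_freq_sq (ζ := ζ) (a := a) hD hb he hg ht))) fun n => abs_mul_sin_le _ _

/-- The majorants depend on the time slab `[τ, T]`, so continuity is proved locally. -/
theorem continuousOn_tsum_modes {F : ℕ → ℝ × ℝ → ℝ} (hF : ∀ n, Continuous (F n))
    (hbd : ∀ τ T, 0 < τ → ∃ u : ℕ → ℝ, Summable u ∧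
      ∀ n (x : ℝ × ℝ), τ ≤ x.1 → x.1 ≤ T → ‖F n x‖ ≤ u n) :
    ContinuousOn (fun x => ∑' n, F n x) (Ioi 0 ×ˢ univ) := by
  refine continuousOn_of_locally_continuousOn fun x hx => ?_
  have hx0 : 0 < x.1 := hx.1
  obtain ⟨u, hu, hle⟩ := hbd (x.1 / 2) (x.1 + 1) (by linarith)
  refine ⟨Ioo (x.1 / 2) (x.1 + 1) ×ˢ univ, isOpen_Ioo.prod isOpen_univ,
    ⟨⟨by linarith, by linarith⟩, mem_univ _⟩, ?_⟩
  exact continuousOn_tsum (fun n => (hF n).continuousOn) hu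
    fun n y hy => hle n y hy.2.1.1.le hy.2.1.2.le

theorem continuousOn_modeSumDeriv (hD : 0 < D) (hb : Summable fun n => |b n|)
    (he : Summable fun n => |e n|) (hg : Continuous g) :
    ContinuousOn (fun q : ℝ × ℝ => modeSumDeriv D ζ a b e g q.1 q.2) (Ioi 0 ×ˢ univ) := by
  refine continuousOn_tsum_modes (fun n => ?_) fun τ T hτ => ?_
  · have := continuous_modal (rate D ζ a n) (b n) (e n) hg
    fun_prop
  · obtain ⟨G, hG⟩ := exists_bound_Icc hg T
    refine ⟨_, (hb.div_const τ).add ((he.mul_right G).mul_left 2), fun n x h1 h2 => ?_⟩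
    exact (abs_mul_sin_le _ _).trans (abs_modalDeriv_le hD ζ a hg hτ h1
      (fun r hr => hG r ⟨hr.1, hr.2.trans h2⟩) n)

theorem contDiffOn_modeSum (hD : 0 < D) (hb : Summable fun n => |b n|)
    (he : Summable fun n => |e n|) (hg : Continuous g) :
    ContDiffOn ℝ 1 (fun q : ℝ × ℝ => modeSum D ζ a b e g q.1 q.2) (Ioi 0 ×ˢ univ) := by
  refine contDiffOn_one_of_partials (isOpen_Ioi.prod isOpen_univ)
    (p := modeSumDeriv D ζ a b e g)
    (q := fun t z => ∑' n, modal (rate D ζ a n) (b n) (e n) g t * freq a n *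
      Real.cos (freq a n * z))
    (fun x hx => hasDerivAt_modeSum hD hb he hg hx.1 x.2)
    (fun x hx => hasDerivAt_sineSeries (summable_mul_freq
      (summable_modal_mul_freq_sq hD hb he hg hx.1)) x.2)
    (continuousOn_modeSumDeriv hD hb he hg) ?_
  refine continuousOn_tsum_modes (F := fun n x => modal (rate D ζ a n) (b n) (e n) g x.1 *
    freq a n * Real.cos (freq a n * x.2)) (fun n => ?_) fun τ T hτ => ?_
  · have := continuous_modal (rate D ζ a n) (b n) (e n) hg
    fun_prop
  · obtain ⟨G, hG⟩ := exists_bound_Icc hg T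
    refine ⟨_, ((hb.div_const τ).add (he.mul_right G)).div_const D, fun n x h1 h2 => ?_⟩
    refine (abs_mul_cos_le _ _).trans (le_trans ?_ (abs_modal_mul_freq_sq_le hD ζ a hg hτ h1
      (fun r hr => hG r ⟨hr.1, hr.2.trans h2⟩) n))
    rw [abs_mul, abs_of_pos (freq_pos a n), pow_two, ← mul_assoc]
    exact le_freq_mul _ (mul_nonneg (abs_nonneg _) (freq_pos a n).le) n

/-- The modal equations, summed, become the heat equation with source `g(t) ∑ e_n sin (ω_n z)`. -/
theorem modeSumDeriv_eq (hD : 0 < D) (hb : Summable fun n => |b n|)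
    (he : Summable fun n => |e n|) (hg : Continuous g) {t : ℝ} (ht : 0 < t) (z : ℝ) :
    modeSumDeriv D ζ a b e g t z =
      D * ((∑' n, -(modal (rate D ζ a n) (b n) (e n) g t * freq a n ^ 2 *
        Real.sin (freq a n * z))) - ζ ^ 2 * modeSum D ζ a b e g t z) +
      g t * ∑' n, e n * Real.sin (freq a n * z) := by
  have hs := summable_modal_mul_freq_sq (ζ := ζ) (a := a) hD hb he hg ht
  have s1 : Summable fun n => modal (rate D ζ a n) (b n) (e n) g t * Real.sin (freq a n * z) :=
    Summable.of_norm_bounded (summable_of_mul_freq (summable_mul_freq hs))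
      fun n => abs_mul_sin_le _ _
  have s2 : Summable fun n => -(modal (rate D ζ a n) (b n) (e n) g t * freq a n ^ 2 *
        Real.sin (freq a n * z)) := by
    refine (Summable.of_norm_bounded hs fun n => (abs_mul_sin_le _ _).trans ?_).neg
    rw [abs_mul, abs_of_pos (pow_pos (freq_pos a n) 2)]
  have s3 : Summable fun n => e n * Real.sin (freq a n * z) :=
    Summable.of_norm_bounded he fun n => abs_mul_sin_le _ _
  unfold modeSum modeSumDeriv
  rw [← tsum_mul_left, ← s2.tsum_sub (s1.mul_left _), ← tsum_mul_left, ← tsum_mul_left,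
    ← ((s2.sub (s1.mul_left _)).mul_left D).tsum_add (s3.mul_left _)]
  refine tsum_congr fun n => ?_
  unfold rate
  ring

end Modes

/-- Existence of classical solutions of `u_t = D (u_zz - ζ² u)`. -/
theorem exists_heatSol {D ζ : ℝ} (hD : 0 < D) (hζ : 0 < ζ) {a : ℝ≥0∞}
    {d d' d'' f f' f'' : ℝ → ℝ} (hd : IsC2 d d' d'') (hf : IsC2 f f' f'') (h0 : f 0 = d 0)
    (h1 : ExitBC a (f 1) (f' 1)) :
    ∃ u r : ℝ → ℝ → ℝ, HeatSol D ζ a d u r ∧ (∀ z ∈ Icc (0 : ℝ) 1, u 0 z = f z) ∧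
      ContDiffOn ℝ 1 (fun q : ℝ × ℝ => u q.1 q.2) (Ioi 0 ×ˢ univ) := by
  obtain ⟨χ, χ', χ'', hχ, hχeq, hχ0, hχ1⟩ := exists_secondary hζ a
  have hψ := isSteady_steadyState hζ a
  set ψ := steadyState ζ a with hψdef
  -- The initial datum of the mode sum is `f` minus both lifts at time `0`. It vanishes at the inlet
  -- because `f 0 = d 0`, so its coefficients are absolutely summable.
  have hw := (hf.sub (hψ.isC2.const_mul (d 0))).sub (hχ.const_mul (d' 0 / D))
  have hw1 := (h1.sub (hψ.exit.const_mul (d 0))).sub (hχ1.const_mul (d' 0 / D))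
  have hw0 : f 0 - d 0 * ψ 0 - d' 0 / D * χ 0 = 0 := by rw [hψ.inlet, hχ0, h0]; ring
  set b : ℕ → ℝ := coeff a (fun z => f z - d 0 * ψ z - d' 0 / D * χ z) with hbdef
  have hb : Summable fun n => |b n| := summable_abs_coeff hw hw0 hw1
  set e : ℕ → ℝ := fun n => -(1 / D) * coeff a χ n with hedef
  have he : Summable fun n => |e n| := by
    simp only [hedef, abs_mul]
    exact (summable_abs_coeff hχ hχ0 hχ1).mul_left _
  have hg := hd.continuous''
  have hdc := hd.continuous
  have hdc' := hd.continuous'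
  have hψc := hψ.isC2.continuous
  have hχc := hχ.continuous
  refine ⟨fun t z => modeSum D ζ a b e d'' t z + (d t * ψ z + d' t / D * χ z),
    fun t z => modeSumDeriv D ζ a b e d'' t z + (d' t * ψ z + d'' t / D * χ z),
    ⟨?_, ?_, ?_, ?_, ?_⟩, ?_, ?_⟩
  · exact ((continuousOn_modeSum hD hb he hg).mono (prod_mono_right (subset_univ _))).add
      (Continuous.continuousOn (by fun_prop))
  · exact ((continuousOn_modeSumDeriv hD hb he hg).mono (prod_mono_right (subset_univ _))).add
      (Continuous.continuousOn (by fun_prop))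
  · intro t ht z _
    exact (hasDerivAt_modeSum hD hb he hg ht z).add (((hd.hasDerivAt t).mul_const _).add
      (((hd.hasDerivAt' t).div_const D).mul_const _))
  · intro t _
    simp [modeSum, hψ.inlet, hχ0]
  · intro t ht
    have hs := summable_modal_mul_freq_sq (ζ := ζ) (a := a) hD hb he hg ht
    have hbc : ExitBC a (∑' n, modal (rate D ζ a n) (b n) (e n) d'' t * Real.sin (freq a n * 1))
      (∑' n, modal (rate D ζ a n) (b n) (e n) d'' t * freq a n * Real.cos (freq a n * 1)) :=
      exitBC_sineSeries a _
    refine ⟨_, _, _, (isC2_sineSeries hs).add ((hψ.isC2.const_mul (d t)).add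
      (hχ.const_mul (d' t / D))), fun z _ => rfl, fun z hz => ?_,
      hbc.add ((hψ.exit.const_mul (d t)).add (hχ1.const_mul (d' t / D)))⟩
    rw [modeSumDeriv_eq hD hb he hg ht, modeSum]
    have h3 : ∑' n, e n * Real.sin (freq a n * z) = -(1 / D) * χ z := by
      rw [eq_tsum_coeff hχ hχ0 hχ1 (Ioo_subset_Icc_self hz), ← tsum_mul_left]
      exact tsum_congr fun n => by simp only [hedef]; ring
    rw [h3, hχeq]
    generalize (∑' n, modal (rate D ζ a n) (b n) (e n) d'' t * Real.sin (freq a n * z)) = X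
    generalize (∑' n, -(modal (rate D ζ a n) (b n) (e n) d'' t * freq a n ^ 2 *
      Real.sin (freq a n * z))) = Y
    field_simp
    ring
  · intro z hz
    have h3 := eq_tsum_coeff hw hw0 hw1 hz
    simp only [modeSum, modal_zero]
    rw [← h3]
    ring
  · refine (contDiffOn_modeSum hD hb he hg).add (ContDiff.contDiffOn ?_)
    have c1 : ContDiff ℝ 1 d := hd.contDiff_two.of_le (by norm_num)
    have c2 : ContDiff ℝ 1 d' := contDiff_one_iff_deriv.2
      ⟨fun x => (hd.hasDerivAt' x).differentiableAt, by
        rwa [show deriv d' = d'' from funext fun x => (hd.hasDerivAt' x).deriv]⟩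
    have c3 : ContDiff ℝ 1 ψ := hψ.isC2.contDiff_two.of_le (by norm_num)
    have c4 : ContDiff ℝ 1 χ := hχ.contDiff_two.of_le (by norm_num)
    exact ((c1.comp contDiff_fst).mul (c3.comp contDiff_snd)).add
      (((c2.comp contDiff_fst).div_const D).mul (c4.comp contDiff_snd))

/-! ### Removal of the drift and conclusion -/

theorem IsC2.derivWithin_eq {f f' f'' w : ℝ → ℝ} (hf : IsC2 f f' f'')
    (hw : EqOn w f (Icc 0 1)) {z : ℝ} (hz : z ∈ Icc (0 : ℝ) 1) :
    derivWithin w (Icc 0 1) z = f' z :=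
  ((hf.hasDerivAt z).hasDerivWithinAt.congr hw (hw hz)).derivWithin
    (uniqueDiffOn_Icc zero_lt_one z hz)

theorem IsC2.deriv_eq {f f' f'' w : ℝ → ℝ} (hf : IsC2 f f' f'')
    (hw : EqOn w f (Icc 0 1)) {z : ℝ} (hz : z ∈ Ioo (0 : ℝ) 1) :
    deriv w z = f' z ∧ deriv (deriv w) z = f'' z := by
  have h1 : ∀ x ∈ Ioo (0 : ℝ) 1, deriv w x = f' x := by
    intro x hx
    have : w =ᶠ[𝓝 x] f := by
      filter_upwards [Icc_mem_nhds hx.1 hx.2] with y hy using hw hy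
    rw [this.deriv_eq, (hf.hasDerivAt x).deriv]
  refine ⟨h1 z hz, ?_⟩
  have : deriv w =ᶠ[𝓝 z] f' := by
    filter_upwards [isOpen_Ioo.mem_nhds hz] with y hy using h1 y hy
  rw [this.deriv_eq, (hf.hasDerivAt' z).deriv]

section Transform

variable {D v k : ℝ} {a : ℝ≥0∞} {d y₀ : ℝ → ℝ} {y u r : ℝ → ℝ → ℝ}

theorem zeta_pos (hD : 0 < D) (hk : -(v ^ 2 / (4 * D)) < k) : 0 < zeta D v k := by
  have h : 0 < v ^ 2 + 4 * k * D := by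
    rw [neg_lt, lt_div_iff₀ (by positivity)] at hk
    linarith
  have := Real.sqrt_pos.2 h
  unfold zeta
  positivity

theorem zeta_sq (hD : 0 < D) (hk : -(v ^ 2 / (4 * D)) < k) :
    4 * D ^ 2 * zeta D v k ^ 2 = v ^ 2 + 4 * k * D := by
  have h : 0 < v ^ 2 + 4 * k * D := by
    rw [neg_lt, lt_div_iff₀ (by positivity)] at hk
    linarith
  have h2 := Real.sq_sqrt h.le
  unfold zeta
  rw [mul_pow, h2]
  field_simp
  ring

/-- The exit condition of a profile `w = exp (c z) f`, `c = v / (2 D)`, in terms of `f`. -/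
theorem exitCondition_iff {f f' f'' w : ℝ → ℝ} (hf : IsC2 f f' f'')
    (hw : EqOn w (fun z => Real.exp (v / (2 * D) * z) * f z) (Icc 0 1)) :
    ExitCondition D v a w ↔ ExitBC a (f 1) (f' 1) := by
  have h := ((isC2_exp (v / (2 * D))).mul hf).derivWithin_eq hw (z := 1) (by simp)
  have h1 : w 1 = Real.exp (v / (2 * D) * 1) * f 1 := hw (by simp)
  have hx := (Real.exp_pos (v / (2 * D) * 1)).ne'
  unfold ExitCondition ExitBC
  rw [h, h1]
  refine and_congr (by simp) (imp_congr_right fun _ => ?_)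
  rw [← mul_right_inj' hx (b := f' 1)]
  constructor <;> intro h2 <;> linear_combination h2

theorem exp_neg_mul_exp (c z : ℝ) : Real.exp (-c * z) * Real.exp (c * z) = 1 := by
  rw [← Real.exp_add]; simp

/-- Removal of the drift: `u = exp (- v z / (2 D)) y` solves `u_t = D (u_zz - ζ² u)`. -/
theorem IsSolution.exists_heatSol (hD : 0 < D) (hk : -(v ^ 2 / (4 * D)) < k)
    (h : IsSolution D v k a d y₀ y) :
    ∃ r, HeatSol D (zeta D v k) a d (fun t z => Real.exp (-(v / (2 * D)) * z) * y t z) r := by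
  set c := v / (2 * D) with hc
  have hu : UniqueDiffOn ℝ (Ioi (0 : ℝ) ×ˢ Icc (0 : ℝ) 1) :=
    (isOpen_Ioi.uniqueDiffOn).prod (uniqueDiffOn_Icc zero_lt_one)
  set F : ℝ × ℝ → ℝ := fun q => y q.1 q.2 with hF
  -- The time derivative is taken from the joint `C¹` regularity, so it is continuous up to `z = 0`
  -- and `z = 1`, where the equation is not imposed.
  set p : ℝ → ℝ → ℝ := fun t z => fderivWithin ℝ F (Ioi 0 ×ˢ Icc 0 1) (t, z) (1, 0) with hp
  have hpc : ContinuousOn (fun q : ℝ × ℝ => p q.1 q.2) (Ioi 0 ×ˢ Icc 0 1) :=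
    (h.contDiffOn.continuousOn_fderivWithin hu le_rfl).clm_apply continuousOn_const
  have hpd : ∀ t, 0 < t → ∀ z ∈ Icc (0 : ℝ) 1, HasDerivAt (fun s => y s z) (p t z) t := by
    intro t ht z hz
    have hmem : (t, z) ∈ Ioi (0 : ℝ) ×ˢ Icc (0 : ℝ) 1 := ⟨ht, hz⟩
    have h1 : HasFDerivWithinAt F _ (Ioi 0 ×ˢ Icc 0 1) (t, z) :=
      (h.contDiffOn.differentiableOn (by norm_num) (t, z) hmem).hasFDerivWithinAt
    have h2 : HasDerivWithinAt (fun s : ℝ => (s, z)) ((1 : ℝ), (0 : ℝ)) (Ioi 0) t :=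
      ((hasDerivAt_id t).prodMk (hasDerivAt_const t z)).hasDerivWithinAt
    exact (h1.comp_hasDerivWithinAt t h2 fun s hs => mk_mem_prod hs hz).hasDerivAt (Ioi_mem_nhds ht)
  have hz2 := zeta_sq hD hk
  have hDne := hD.ne'
  refine ⟨fun t z => Real.exp (-c * z) * p t z, ?_, ?_, ?_, ?_, ?_⟩
  · exact ContinuousOn.mul (by fun_prop) h.continuousOn
  · exact ContinuousOn.mul (by fun_prop) hpc
  · exact fun t ht z hz => (hpd t ht z hz).const_mul _
  · intro t ht
    simp [h.inlet t ht]
  · intro t ht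
    obtain ⟨g, g', g'', hg, hgy⟩ := exists_isC2_extension_Icc (h.profile t ht.le)
    have hf := (isC2_exp (-c)).mul hg
    refine ⟨_, _, _, hf, fun z hz => by rw [hgy hz], fun z hz => ?_, ?_⟩
    · have h1 := h.pde t ht z hz
      rw [(hpd t ht z (Ioo_subset_Icc_self hz)).deriv, (hg.deriv_eq hgy hz).1,
        (hg.deriv_eq hgy hz).2, hgy (Ioo_subset_Icc_self hz)] at h1
      rw [h1, hc]
      -- Completing the square: the drift contributes `v² / (4 D)` to the zero-order coefficient.
      have e : D * zeta D v k ^ 2 = v ^ 2 / (4 * D) + k := by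
        field_simp
        linear_combination hz2
      have e2 : D * (v / (2 * D)) ^ 2 = v ^ 2 / (4 * D) := by
        field_simp
        norm_num
      have e3 : D * (v / (2 * D)) = v / 2 := by field_simp
      linear_combination (Real.exp (-(v / (2 * D)) * z) * g z) * (e - e2) +
        2 * (Real.exp (-(v / (2 * D)) * z) * g' z) * e3
    · refine (exitCondition_iff (D := D) (v := v) hf fun z hz => ?_).1 (h.exit t ht.le)
      simp only [← hc]
      rw [hgy hz, ← mul_assoc, mul_comm (Real.exp (c * z)), exp_neg_mul_exp, one_mul]

/-- The weight `exp (-v z / D)` is the square of the factor that removes the drift. -/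
theorem weightedNorm_eq (D v : ℝ) (w : ℝ → ℝ) :
    weightedNorm D v w =
      Real.sqrt (∫ z in (0 : ℝ)..1, (Real.exp (-(v / (2 * D)) * z) * w z) ^ 2) := by
  unfold weightedNorm
  congr 1
  refine integral_congr fun z _ => ?_
  rw [mul_pow, ← Real.exp_nat_mul]
  congr 2
  push_cast
  ring

theorem exists_isSolution (hD : 0 < D) (hk : -(v ^ 2 / (4 * D)) < k)
    (hd : ContDiffOn ℝ 2 d (Ici 0)) (hy₀ : ContDiffOn ℝ 2 y₀ (Icc 0 1)) (h0 : y₀ 0 = d 0)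
    (h1 : ExitCondition D v a y₀) : ∃ y, IsSolution D v k a d y₀ y := by
  set c := v / (2 * D) with hc
  obtain ⟨e, e', e'', he, hde⟩ := exists_isC2_extension_Ici hd
  obtain ⟨g, g', g'', hg, hgy⟩ := exists_isC2_extension_Icc hy₀
  have hf := (isC2_exp (-c)).mul hg
  have hy₀f : EqOn y₀ (fun z => Real.exp (c * z) * (Real.exp (-c * z) * g z)) (Icc 0 1) := by
    intro z hz
    simp only
    rw [hgy hz, ← mul_assoc, mul_comm (Real.exp (c * z)), exp_neg_mul_exp, one_mul]
  have hbc := (exitCondition_iff (D := D) (v := v) hf hy₀f).1 h1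
  have hf0 : Real.exp (-c * 0) * g 0 = e 0 := by
    rw [← hgy (by simp), h0, hde (by simp)]; simp
  obtain ⟨u, r, hu, hu0, huC⟩ := TransportPDE.exists_heatSol hD (zeta_pos hD hk) he hf hf0 hbc
  -- `HeatSol` describes profiles for `t > 0` only; at `t = 0` the initial datum supplies the
  -- regularity and the exit condition.
  have hprof : ∀ t, 0 ≤ t → ∃ f f' f'' : ℝ → ℝ, IsC2 f f' f'' ∧
      EqOn (u t) f (Icc 0 1) ∧ ExitBC a (f 1) (f' 1) := by
    intro t ht
    rcases ht.eq_or_lt with rfl | ht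
    · exact ⟨_, _, _, hf, hu0, hbc⟩
    · obtain ⟨f, f', f'', k1, k2, -, k4⟩ := hu.profile t ht
      exact ⟨f, f', f'', k1, k2, k4⟩
  have hz2 := zeta_sq hD hk
  have hDne := hD.ne'
  refine ⟨fun t z => Real.exp (c * z) * u t z, ?_, ?_, ?_, ?_, ?_, ?_, ?_⟩
  · exact ContinuousOn.mul (by fun_prop) hu.continuousOn
  · exact ContDiffOn.mul (ContDiff.contDiffOn (by fun_prop))
      (huC.mono (prod_mono_right (subset_univ _)))
  · intro t ht
    obtain ⟨f, f', f'', k1, k2, -⟩ := hprof t ht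
    exact ContDiffOn.mul (ContDiff.contDiffOn (by fun_prop)) (k1.contDiff_two.contDiffOn.congr k2)
  · intro t ht
    rw [hu.inlet t ht, hde ht]; simp
  · intro t ht
    obtain ⟨f, f', f'', k1, k2, k3⟩ := hprof t ht
    exact (exitCondition_iff (D := D) (v := v) k1 fun z hz => by simp only [k2 hz, hc]).2 k3
  · intro z hz
    rw [hu0 z hz, hy₀f hz]
  · intro t ht z hz
    obtain ⟨f, f', f'', k1, k2, k3, -⟩ := hu.profile t ht
    have hz' := Ioo_subset_Icc_self hz
    have hE := ((isC2_exp c).mul k1).deriv_eq (w := fun z => Real.exp (c * z) * u t z)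
      (fun x hx => by simp only [k2 x hx]) hz
    rw [((hu.hasDerivAt t ht z hz').const_mul _).deriv, hE.1, hE.2, k3 z hz, k2 z hz', hc]
    have e1 : D * zeta D v k ^ 2 = v ^ 2 / (4 * D) + k := by
      field_simp
      linear_combination hz2
    have e2 : D * (v / (2 * D)) ^ 2 = v ^ 2 / (4 * D) := by
      field_simp
      norm_num
    have e3 : D * (v / (2 * D)) = v / 2 := by field_simp
    have e4 : v * (v / (2 * D)) = 2 * (v ^ 2 / (4 * D)) := by
      field_simp
      norm_num
    linear_combination (Real.exp (v / (2 * D) * z) * f z) * (e4 - e1 - e2) -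
        2 * (Real.exp (v / (2 * D) * z) * f' z) * e3

theorem IsSolution.eq_of_isSolution (hD : 0 < D) (hk : -(v ^ 2 / (4 * D)) < k)
    {y' : ℝ → ℝ → ℝ} (h : IsSolution D v k a d y₀ y) (h' : IsSolution D v k a d y₀ y') {t : ℝ}
    (ht : 0 ≤ t) {z : ℝ} (hz : z ∈ Icc (0 : ℝ) 1) : y' t z = y t z := by
  obtain ⟨r, hr⟩ := h.exists_heatSol hD hk
  obtain ⟨r', hr'⟩ := h'.exists_heatSol hD hk
  have hs := hr'.sub hr
  simp only [sub_self] at hs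
  have h0 := hs.eq_zero hD (fun z hz => by rw [h.initial z hz, h'.initial z hz, sub_self]) ht hz
  exact mul_left_cancel₀ (Real.exp_pos _).ne' (sub_eq_zero.1 h0)

theorem abs_le_maxAbs (hd : ContinuousOn d (Ici 0)) {t s : ℝ} (hs : s ∈ Icc 0 t) :
    |d s| ≤ maxAbs d t :=
  le_csSup (isCompact_Icc.image_of_continuousOn
    ((hd.mono Icc_subset_Ici_self).abs)).bddAbove (mem_image_of_mem _ hs)

theorem IsSolution.weightedNorm_le (hD : 0 < D) (hk : -(v ^ 2 / (4 * D)) < k)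
    (hd : ContinuousOn d (Ici 0)) (h : IsSolution D v k a d y₀ y) {t : ℝ} (ht : 0 ≤ t) {ε : ℝ}
    (hε : 0 < ε) :
    weightedNorm D v (y t) ≤
      Real.exp (-(D * (zeta D v k ^ 2 + Real.pi ^ 2 * (1 - mu 1 a) ^ 2) * t)) *
        (Real.sqrt (1 + ε) * weightedNorm D v y₀) +
      Real.sqrt (1 + ε⁻¹) * gain (zeta D v k) a * maxAbs d t := by
  have hζ := zeta_pos hD hk
  obtain ⟨r, hr⟩ := h.exists_heatSol hD hk
  have key := hr.sqrt_integral_sq_le hD (isSteady_steadyState hζ a) ht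
    (fun s hs => abs_le_maxAbs hd hs) hε
  rw [sqrt_integral_steadyState_sq hζ, ← (summable_gainTerm_and_gain hζ a).2,
    ← weightedNorm_eq, ← weightedNorm_eq] at key
  have e1 : weightedNorm D v (y 0) = weightedNorm D v y₀ := by
    unfold weightedNorm
    congr 1
    refine integral_congr fun z hz => ?_
    rw [uIcc_of_le zero_le_one] at hz
    simp only [h.initial z hz]
  have e2 : freq a 0 ^ 2 = Real.pi ^ 2 * (1 - mu 1 a) ^ 2 := by
    unfold freq
    push_cast
    ring
  rwa [e1, e2] at key

end Transform

end TransportPDE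

theorem corollary4p1 (D v k : ℝ) (hD : 0 < D) (hv : 0 ≤ v) (hk : -(v ^ 2 / (4 * D)) < k)
    (a : ℝ≥0∞) :
    (Summable (fun n : ℕ => TransportPDE.gainTerm (TransportPDE.zeta D v k) a (n + 1)) ∧
      TransportPDE.gain (TransportPDE.zeta D v k) a =
        TransportPDE.gainClosedForm (TransportPDE.zeta D v k) a) ∧
    ∀ d y₀ : ℝ → ℝ, ContDiffOn ℝ 2 d (Ici 0) → ContDiffOn ℝ 2 y₀ (Icc 0 1) →
      y₀ 0 = d 0 → TransportPDE.ExitCondition D v a y₀ →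
      ∃ y : ℝ → ℝ → ℝ, TransportPDE.IsSolution D v k a d y₀ y ∧
        (∀ y' : ℝ → ℝ → ℝ, TransportPDE.IsSolution D v k a d y₀ y' →
          ∀ t, 0 ≤ t → ∀ z ∈ Icc (0 : ℝ) 1, y' t z = y t z) ∧
        ∀ t, 0 ≤ t → ∀ ε, 0 < ε →
          TransportPDE.weightedNorm D v (y t) ≤
            Real.exp (-(D * (TransportPDE.zeta D v k ^ 2 +
                Real.pi ^ 2 * (1 - TransportPDE.mu 1 a) ^ 2) * t)) *
              (Real.sqrt (1 + ε) * TransportPDE.weightedNorm D v y₀) +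
            Real.sqrt (1 + ε⁻¹) * TransportPDE.gain (TransportPDE.zeta D v k) a *
              TransportPDE.maxAbs d t := by
  refine ⟨TransportPDE.summable_gainTerm_and_gain (TransportPDE.zeta_pos hD hk) a,
    fun d y₀ hd hy₀ h0 h1 => ?_⟩
  obtain ⟨y, hy⟩ := TransportPDE.exists_isSolution hD hk hd hy₀ h0 h1
  exact ⟨y, hy, fun y' hy' t ht z hz => hy.eq_of_isSolution hD hk hy' ht hz,
    fun t ht ε hε => hy.weightedNorm_le hD hk hd.continuousOn ht hε⟩
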